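/- **Conventions.** We work in many-sorted first-order logic with equality; all carriers are non-empty. Let $\mathcal T_0$ be a set of closed formulas over a signature $\Pi_0$, let $\Sigma$ be a set of additional (extension) function symbols, $\Pi=\Pi_0\cup\Sigma$, and let $C$ be a family of additional constants (at least one of each sort); $\Pi^C$ is $\Pi$ together with $C$, and for a set $F$ of function symbols and a set $A\subseteq C$, a $(\Pi_0\cup F)^A$-formula is one built from symbols in $\Pi_0$, $F$ and $A$. An *extension term* is a term whose root symbol is in $\Sigma$. A ground clause is *flat* if all symbols below extension symbols are constants, and *linear* if any two of its extension terms that contain a common constant are identical and no extension term contains two occurrences of a constant. A clause with variables is flat, resp. linear, if the same holds with "variables" in place of "constants". For a set $\mathcal K$ of $\Pi$-clauses (universally closed) and a set $G$ of ground $\Pi^C$-clauses, ${\sf est}(\mathcal K,G)$ is the set of ground extension terms occurring in $\mathcal K$ or $G$, and for a set $T$ of ground terms $\mathcal K[T]$ is the set of instances of clauses of $\mathcal K$ in which all extension terms are in $T$. The extension $\mathcal T_0\subseteq\mathcal T_0\cup\mathcal K$ is *local* if for every finite set $G$ of ground $\Pi^C$-clauses, $\mathcal T_0\cup\mathcal K\cup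 G\models\bot$ iff $\mathcal T_0\cup\mathcal K[{\sf est}(\mathcal K,G)]\cup G\models\bot$. A finite set of ground clauses is identified with its conjunction. $\mathcal T_0$ *allows quantifier elimination* if every $\Pi_0$-formula is equivalent modulo $\mathcal T_0$ to a quantifier-free $\Pi_0$-formula with no additional free variables. A ground $\Pi^C$-formula $\psi$ is a *$\mathcal T$-general uniform interpolant* of a ground $\Pi^C$-formula $\phi$ w.r.t. $\Sigma_s\cup A$ (where $\Sigma_s\subseteq\Sigma$, $A\subseteq C$) if $\psi$ is a $(\Pi_0\cup\Sigma_s)^{A}$-formula, $\phi\models_{\mathcal T}\psi$, and for every ground $\Pi^C$-formula $\theta$ such that all extension symbols and all constants in $C$ which $\theta$ shares with $\phi$ are in $\Sigma_s\cup A$: if $\phi\models_{\mathcal T}\theta$ then $\psi\models_{\mathcal T}\theta$. **Algorithm 1** (input $\mathcal K$, $G$, $T$; shared symbols $\Sigma_s\subseteq\Sigma$, $C_s\subseteq C$). Step 1: purify $N=\mathcal K[T]\cup G$, replacing each extension term $t$ occurring in $N$ by a new constant $c_t$; this gives sets of $\Pi_0$-clauses $\mathcal K_0\cup G_0$; let ${\sf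 Con}_0$ be the set of all clauses $\bigwedge_i c_i\approx d_i\to c_t\approx c_{t'}$ for $t=f(c_1,\dots,c_n)$, $t'=f(d_1,\dots,d_n)$ extension terms occurring in $N$ (with purified arguments), and put $G_1=\mathcal K_0\cup G_0\cup{\sf Con}_0$. Step 2: the constants in $C_s$, the constants $c_t$ for the terms $t$ in $N$ with root in $\Sigma_s$, and the constants which are arguments of $\Sigma_s$-functions in these terms are kept; all other constants are replaced by existentially quantified variables $\overline x$. Step 3: using quantifier elimination in $\mathcal T_0$, compute a quantifier-free $\Pi_0$-formula $\Gamma_1$ over the kept constants which is equivalent to $\exists\overline x\,G_1$ modulo $\mathcal T_0$. Step 4: the output $\Gamma_T$ is obtained from $\Gamma_1$ by replacing each $c_t$ back by $t$. **Theorem.** Assume that $\mathcal T_0$ allows quantifier elimination. Let $\Sigma$ be the disjoint union of $\Sigma_s$, $\Sigma_1$ and $\Sigma_i$, let $\mathcal K$ be a finite set of flat and linear $\Pi$-clauses in each of which every variable occurs below an extension symbol, let $G$ be a finite set of flat and linear ground $(\Pi_0\cup\Sigma_s\cup\Sigma_1)^C$-clauses, and let $C_s\subseteq C$. (1) Let $T$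 be a finite set of flat ground $\Pi^C$-terms with ${\sf est}(\mathcal K,G)\subseteq T$. Then Algorithm 1 has an output on $\mathcal K$, $G$, $T$, and every output $\Gamma_T$ satisfies $G\models_{\mathcal T_0\cup\mathcal K}\Gamma_T$. (2) Assume in addition that $\mathcal T_0\subseteq\mathcal T_0\cup\mathcal K$ is a local theory extension, that $\mathcal K=\mathcal K_s\cup\mathcal K_1\cup\mathcal K_i$, where $\mathcal K_s$, $\mathcal K_1$, $\mathcal K_i$ consist of $\Pi_0\cup\Sigma_s$-clauses, $\Pi_0\cup\Sigma_1$-clauses and $\Pi_0\cup\Sigma_i$-clauses respectively, and that every symbol in $\Sigma_1$ occurs in $G$. Let $\overline C_s$ consist of $C_s$ together with all constants in $C$ which occur as arguments of functions in $\Sigma_s$ in $G$. Then Algorithm 1 has an output on $\mathcal K_s\cup\mathcal K_1$, $G$ and $T={\sf est}(\mathcal K,G)$, and every output $\Gamma$ is a $\mathcal T_0\cup\mathcal K$-general uniform interpolant of $G$ w.r.t. $\Sigma_s\cup\overline C_s$. -/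

import Mathlib

universe u v w

namespace MSL

/-! ### Many-sorted first-order logic (with equality) -/

/-- A many-sorted signature over the set of sorts `S`: function symbols `f : s₁ … sₙ → s` and
predicate symbols `P : s₁ … sₙ`. Nullary function symbols are constants. -/
structure Signature (S : Type u) where
  Func : Type u
  dom : Func → List S
  cod : Func → S
  Pred : Type u
  pdom : Pred → List S

/-- A family of additional (extension) function symbols over the sorts `S`. -/
structure ExtSymbols (S : Type u) where
  Func : Type u
  dom : Func → List S
  cod : Func → S

variable {S : Type u}

/-- The signature `Π₀ ∪ Σ`. -/
abbrev Signature.extend (L : Signature S) (E : ExtSymbols S) : Signature S where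
  Func := L.Func ⊕ E.Func
  dom := Sum.elim L.dom E.dom
  cod := Sum.elim L.cod E.cod
  Pred := L.Pred
  pdom := L.pdom

/-- Terms over `L` whose generators of sort `s` are the elements of `X s`. The generators play
the role of variables, or of additional constants: for a sorted family `C` of fresh constants,
the ground `Π^C`-terms are the elements of `Term Π C s`. -/
inductive Term (L : Signature S) (X : S → Type v) : S → Type (max u v)
  | var {s : S} (x : X s) : Term L X s
  | func (f : L.Func) (ts : (i : Fin (L.dom f).length) → Term L X ((L.dom f).get i)) :
      Term L X (L.cod f)

/-- A total many-sorted structure, with non-empty carriers. -/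
structure Structure (L : Signature S) where
  carrier : S → Type u
  nonempty : ∀ s, Nonempty (carrier s)
  fn : (f : L.Func) → ((i : Fin (L.dom f).length) → carrier ((L.dom f).get i)) →
    carrier (L.cod f)
  rel : (P : L.Pred) → ((i : Fin (L.pdom P).length) → carrier ((L.pdom P).get i)) → Prop

/-- The reduct of a `Π₀ ∪ Σ`-structure to `Π₀`. -/
def Structure.reduct {L : Signature S} {E : ExtSymbols S} (M : Structure (L.extend E)) :
    Structure L where
  carrier := M.carrier
  nonempty := M.nonempty
  fn f a := M.fn (Sum.inl f) a
  rel P a := M.rel P a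

/-- Valuations of the generators `X`. A `Π^C`-structure is a `Π`-structure `M` together with
an element of `Assignment M C`. -/
abbrev Assignment {L : Signature S} (M : Structure L) (X : S → Type v) : Type (max u v) :=
  (s : S) → X s → M.carrier s

section Terms

variable {L : Signature S} {X : S → Type v}

def Term.eval (M : Structure L) (a : Assignment M X) : {s : S} → Term L X s → M.carrier s
  | _, .var x => a _ x
  | _, .func f ts => M.fn f (fun i => (ts i).eval M a)

def Term.subst {Y : S → Type w} (σ : (s : S) → X s → Term L Y s) :
    {s : S} → Term L X s → Term L Y s
  | _, .var x => σ _ x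
  | _, .func f ts => .func f (fun i => (ts i).subst σ)

/-- All subterms, including the term itself. -/
def Term.subterms : {s : S} → Term L X s → Set (Sigma (Term L X))
  | _, .var x => {⟨_, .var x⟩}
  | _, .func f ts => {⟨_, .func f ts⟩} ∪ ⋃ i, (ts i).subterms

open Classical in
/-- The number of occurrences of the term `k` in a term. -/
noncomputable def Term.occ (k : Sigma (Term L X)) : {s : S} → Term L X s → ℕ
  | _, .var x => if k = ⟨_, .var x⟩ then 1 else 0
  | _, .func f ts => (if k = ⟨_, .func f ts⟩ then 1 else 0) + ∑ i, (ts i).occ k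

/-- The generators that occur in a term. -/
def Term.vars {s : S} (t : Term L X s) : Set (Sigma X) :=
  {x | (⟨x.1, .var x.2⟩ : Sigma (Term L X)) ∈ t.subterms}

/-- The function symbols that occur in a term. -/
def Term.funcs {s : S} (t : Term L X s) : Set L.Func :=
  {f | ∃ ts, (⟨_, .func f ts⟩ : Sigma (Term L X)) ∈ t.subterms}

/-- The term is a single generator. -/
def IsVarTerm (t : Sigma (Term L X)) : Prop :=
  ∃ (s : S) (x : X s), t = ⟨s, .var x⟩

/-- The term is a constant of `Π^X`: an element of `X` or a nullary function symbol of `Π`. -/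
def IsConstTerm (t : Sigma (Term L X)) : Prop :=
  IsVarTerm t ∨ ∃ (f : L.Func) (ts : _), L.dom f = [] ∧ t = ⟨L.cod f, .func f ts⟩

end Terms

/-- First-order formulas with named variables `X`. -/
inductive Formula (L : Signature S) (X : S → Type v) : Type (max u v)
  | falsum : Formula L X
  | eq {s : S} (t t' : Term L X s) : Formula L X
  | rel (P : L.Pred) (ts : (i : Fin (L.pdom P).length) → Term L X ((L.pdom P).get i)) :
      Formula L X
  | imp (φ ψ : Formula L X) : Formula L X
  | all {s : S} (x : X s) (φ : Formula L X) : Formula L X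

/-- Truth under a valuation; `all x φ` holds when `φ` holds under all `x`-variants. -/
def Formula.Holds {L : Signature S} {X : S → Type v} (M : Structure L) :
    Formula L X → Assignment M X → Prop
  | .falsum, _ => False
  | .eq t t', a => t.eval M a = t'.eval M a
  | .rel P ts, a => M.rel P (fun i => (ts i).eval M a)
  | .imp φ ψ, a => φ.Holds M a → ψ.Holds M a
  | .all (s := s) x φ, a => ∀ b : Assignment M X,
      (∀ (r : S) (y : X r), (⟨r, y⟩ : Sigma X) ≠ ⟨s, x⟩ → b r y = a r y) → φ.Holds M b

def Formula.freeVars {L : Signature S} {X : S → Type v} : Formula L X → Set (Sigma X)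
  | .falsum => ∅
  | .eq t t' => t.vars ∪ t'.vars
  | .rel _ ts => ⋃ i, (ts i).vars
  | .imp φ ψ => φ.freeVars ∪ ψ.freeVars
  | .all (s := s) x φ => φ.freeVars \ {⟨s, x⟩}

/-- Quantifier-free formulas. For a family `C` of constants, `QFFormula Π C` is the set of ground
`Π^C`-formulas. -/
inductive QFFormula (L : Signature S) (X : S → Type v) : Type (max u v)
  | falsum : QFFormula L X
  | eq {s : S} (t t' : Term L X s) : QFFormula L X
  | rel (P : L.Pred) (ts : (i : Fin (L.pdom P).length) → Term L X ((L.pdom P).get i)) :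
      QFFormula L X
  | imp (φ ψ : QFFormula L X) : QFFormula L X

section QF

variable {L : Signature S} {X : S → Type v}

def QFFormula.Holds (M : Structure L) (a : Assignment M X) : QFFormula L X → Prop
  | .falsum => False
  | .eq t t' => t.eval M a = t'.eval M a
  | .rel P ts => M.rel P (fun i => (ts i).eval M a)
  | .imp φ ψ => φ.Holds M a → ψ.Holds M a

def QFFormula.vars : QFFormula L X → Set (Sigma X)
  | .falsum => ∅
  | .eq t t' => t.vars ∪ t'.vars
  | .rel _ ts => ⋃ i, (ts i).vars
  | .imp φ ψ => φ.vars ∪ ψ.vars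

def QFFormula.funcs : QFFormula L X → Set L.Func
  | .falsum => ∅
  | .eq t t' => t.funcs ∪ t'.funcs
  | .rel _ ts => ⋃ i, (ts i).funcs
  | .imp φ ψ => φ.funcs ∪ ψ.funcs

/-- Negation. -/
def QFFormula.neg (φ : QFFormula L X) : QFFormula L X := .imp φ .falsum

/-- Disjunction. -/
def QFFormula.or (φ ψ : QFFormula L X) : QFFormula L X := .imp φ.neg ψ

end QF

/-- The individual variables: countably many of each sort. -/
abbrev Var (_ : S) : Type := ℕ

/-- Closed formulas. -/
abbrev Sentence (L : Signature S) : Type u :=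
  {φ : Formula L (Var (S := S)) // φ.freeVars = ∅}

/-- `M` is a model of the set `T` of closed formulas. -/
def Structure.IsModel {L : Signature S} (M : Structure L) (T : Set (Sentence L)) : Prop :=
  ∀ φ ∈ T, ∀ a : Assignment M (Var (S := S)), φ.1.Holds M a

/-- `T` allows quantifier elimination: every formula `φ` (over any supply of variables) is
equivalent modulo `T` to a quantifier-free formula with no further variables. -/
def AllowsQE {L : Signature S} (T : Set (Sentence L)) : Prop :=
  ∀ (X : S → Type u) (φ : Formula L X), ∃ ψ : QFFormula L X, ψ.vars ⊆ φ.freeVars ∧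
    ∀ M : Structure L, M.IsModel T → ∀ a : Assignment M X, φ.Holds M a ↔ ψ.Holds M a

/-! ### Clauses -/

/-- Literals; the Boolean is the sign (`true`: positive). -/
inductive Literal (L : Signature S) (X : S → Type v) : Type (max u v)
  | eq (sign : Bool) {s : S} (t t' : Term L X s) : Literal L X
  | rel (sign : Bool) (P : L.Pred)
      (ts : (i : Fin (L.pdom P).length) → Term L X ((L.pdom P).get i)) : Literal L X

/-- A clause is a finite disjunction of literals. `Clause Π Var` is used for (universally closed)
clauses with variables, `Clause Π C` for ground `Π^C`-clauses. -/
abbrev Clause (L : Signature S) (X : S → Type v) : Type (max u v) := List (Literal L X)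

section Clauses

variable {L : Signature S} {X : S → Type v}

def Literal.toQF : Literal L X → QFFormula L X
  | .eq true t t' => .eq t t'
  | .eq false t t' => (QFFormula.eq t t').neg
  | .rel true P ts => .rel P ts
  | .rel false P ts => (QFFormula.rel P ts).neg

def Clause.toQF (D : Clause L X) : QFFormula L X :=
  (D.map Literal.toQF).foldr QFFormula.or QFFormula.falsum

def Clause.Holds (M : Structure L) (a : Assignment M X) (D : Clause L X) : Prop :=
  (Clause.toQF D).Holds M a

def Literal.subst {Y : S → Type w} (σ : (s : S) → X s → Term L Y s) :
    Literal L X → Literal L Y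
  | .eq b t t' => .eq b (t.subst σ) (t'.subst σ)
  | .rel b P ts => .rel b P (fun i => (ts i).subst σ)

def Clause.subst {Y : S → Type w} (σ : (s : S) → X s → Term L Y s) (D : Clause L X) :
    Clause L Y :=
  D.map (Literal.subst σ)

def Literal.subterms : Literal L X → Set (Sigma (Term L X))
  | .eq _ t t' => t.subterms ∪ t'.subterms
  | .rel _ _ ts => ⋃ i, (ts i).subterms

/-- All terms that occur in a clause. -/
def Clause.subterms (D : Clause L X) : Set (Sigma (Term L X)) :=
  {t | ∃ l ∈ D, t ∈ Literal.subterms l}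

/-- The generators (variables, or additional constants) that occur in a clause. -/
def Clause.vars (D : Clause L X) : Set (Sigma X) :=
  {x | (⟨x.1, .var x.2⟩ : Sigma (Term L X)) ∈ Clause.subterms D}

end Clauses

/-! ### Theory extensions -/

section Extensions

variable {L : Signature S} {E : ExtSymbols S} {X : S → Type v}

/-- The possible tuples of arguments of the extension symbol `f`. -/
abbrev ExtArgs (L : Signature S) (E : ExtSymbols S) (X : S → Type v) (f : E.Func) :
    Type (max u v) :=
  (i : Fin (E.dom f).length) → Term (L.extend E) X ((E.dom f).get i)

/-- The term `f(ts)`, for an extension symbol `f`. -/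
def extApp (f : E.Func) (ts : ExtArgs L E X f) : Term (L.extend E) X (E.cod f) :=
  Term.func (L := L.extend E) (Sum.inr f) ts

/-- An extension term: a term that starts with an extension symbol. -/
def IsExtTerm (t : Sigma (Term (L.extend E) X)) : Prop :=
  ∃ (f : E.Func) (ts : ExtArgs L E X f), t = ⟨E.cod f, extApp f ts⟩

/-- `t` is an extension term whose root symbol belongs to `F`. -/
def HasRootIn (F : Set E.Func) (t : Sigma (Term (L.extend E) X)) : Prop :=
  ∃ (f : E.Func) (ts : ExtArgs L E X f), f ∈ F ∧ t = ⟨E.cod f, extApp f ts⟩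

/-- The extension symbols that occur in a clause. -/
def Clause.extFuncs (D : Clause (L.extend E) X) : Set E.Func :=
  {f | ∃ t ∈ Clause.subterms D, HasRootIn {f} t}

/-- The extension symbols that occur in a quantifier-free formula. -/
def QFFormula.extFuncs (φ : QFFormula (L.extend E) X) : Set E.Func :=
  {f | (Sum.inr f : L.Func ⊕ E.Func) ∈ φ.funcs}

/-- In the given set of terms, everything directly (hence everything) below an extension symbol
satisfies `P`. -/
def FlatWrt (P : Sigma (Term (L.extend E) X) → Prop) (U : Set (Sigma (Term (L.extend E) X))) :
    Prop :=
  ∀ (f : E.Func) (ts : ExtArgs L E X f),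
    (⟨E.cod f, extApp f ts⟩ : Sigma (Term (L.extend E) X)) ∈ U → ∀ i, P ⟨_, ts i⟩

/-- If something satisfying `P` occurs in two extension terms then these are equal, and no
extension term contains two occurrences of it. -/
def LinearWrt (P : Sigma (Term (L.extend E) X) → Prop)
    (U : Set (Sigma (Term (L.extend E) X))) : Prop :=
  (∀ k, P k → ∀ t ∈ U, ∀ t' ∈ U, IsExtTerm t → IsExtTerm t' →
    k ∈ t.2.subterms → k ∈ t'.2.subterms → t = t') ∧
  (∀ k, P k → ∀ t ∈ U, IsExtTerm t → t.2.occ k ≤ 1)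

/-- A ground clause is flat if all symbols below extension symbols are constants. -/
def Clause.GroundFlat (D : Clause (L.extend E) X) : Prop :=
  FlatWrt IsConstTerm (Clause.subterms D)

/-- A ground clause is linear if a constant that occurs in two extension terms occurs only in
identical ones, and no extension term contains two occurrences of a constant. -/
def Clause.GroundLinear (D : Clause (L.extend E) X) : Prop :=
  LinearWrt IsConstTerm (Clause.subterms D)

/-- Flatness of an extension clause: all symbols below extension symbols are variables
(constants, if the clause has no variables). -/
def Clause.Flat (D : Clause (L.extend E) X) : Prop :=
  (Clause.vars D = ∅ → Clause.GroundFlat D) ∧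
  (Clause.vars D ≠ ∅ → FlatWrt IsVarTerm (Clause.subterms D))

/-- Linearity of an extension clause, in terms of variables (of constants, if the clause has
no variables). -/
def Clause.Linear (D : Clause (L.extend E) X) : Prop :=
  (Clause.vars D = ∅ → Clause.GroundLinear D) ∧
  (Clause.vars D ≠ ∅ → LinearWrt IsVarTerm (Clause.subterms D))

/-- Every variable of the clause occurs below an extension symbol. -/
def Clause.VarsBelowExt (D : Clause (L.extend E) X) : Prop :=
  ∀ x ∈ Clause.vars D, ∃ t ∈ Clause.subterms D, IsExtTerm t ∧ x ∈ t.2.vars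

/-- `M` is a model of `T₀ ∪ K`, the clauses in `K` being universally closed. -/
def IsExtModel (T₀ : Set (Sentence L)) (K : Set (Clause (L.extend E) (Var (S := S))))
    (M : Structure (L.extend E)) : Prop :=
  M.reduct.IsModel T₀ ∧ ∀ D ∈ K, ∀ a : Assignment M (Var (S := S)), Clause.Holds M a D

variable {C : S → Type u}

/-- `Φ ⊨ θ` modulo `T₀ ∪ K`, for a set `Φ` of ground `Π^C`-formulas (read as a conjunction) and a
ground `Π^C`-formula `θ`. -/
def Entails (T₀ : Set (Sentence L)) (K : Set (Clause (L.extend E) (Var (S := S))))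
    (Φ : Set (QFFormula (L.extend E) C)) (θ : QFFormula (L.extend E) C) : Prop :=
  ∀ (M : Structure (L.extend E)) (a : Assignment M C), IsExtModel T₀ K M →
    (∀ φ ∈ Φ, φ.Holds M a) → θ.Holds M a

/-- The extension terms that occur in a set of ground clauses. -/
def extTerms (N : Set (Clause (L.extend E) C)) : Set (Sigma (Term (L.extend E) C)) :=
  {t | IsExtTerm t ∧ ∃ D ∈ N, t ∈ Clause.subterms D}

/-- `est(K, G)`: the ground extension terms that occur in `K` or `G`. (A variable-free term that
occurs in `K` is regarded as a `Π^C`-term; the substitution `σ` has no effect on it.) -/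
def est (K : Set (Clause (L.extend E) (Var (S := S)))) (G : Set (Clause (L.extend E) C)) :
    Set (Sigma (Term (L.extend E) C)) :=
  extTerms G ∪
  {t | ∃ D ∈ K, ∃ t' ∈ Clause.subterms D, IsExtTerm t' ∧ t'.2.vars = ∅ ∧
    ∃ σ : (s : S) → Var s → Term (L.extend E) C s, t = ⟨t'.1, t'.2.subst σ⟩}

/-- `K[T]`: the instances of clauses of `K` in which all extension terms belong to `T`. (If every
variable of `K` occurs below an extension symbol, then all such instances are ground.) -/
def instances (K : Set (Clause (L.extend E) (Var (S := S))))
    (T : Set (Sigma (Term (L.extend E) C))) : Set (Clause (L.extend E) C) :=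
  {D' | ∃ D ∈ K, ∃ σ : (s : S) → Var s → Term (L.extend E) C s,
    D' = Clause.subst σ D ∧ ∀ t ∈ Clause.subterms D', IsExtTerm t → t ∈ T}

/-- `T₀ ⊆ T₀ ∪ K` is a local theory extension: for every finite set `G` of ground `Π^C`-clauses,
`T₀ ∪ K ∪ G` is unsatisfiable iff `T₀ ∪ K[est(K, G)] ∪ G` is. -/
def IsLocalExtension (C : S → Type u) (T₀ : Set (Sentence L))
    (K : Set (Clause (L.extend E) (Var (S := S)))) : Prop :=
  ∀ G : Set (Clause (L.extend E) C), G.Finite →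
    ((¬ ∃ (M : Structure (L.extend E)) (a : Assignment M C), IsExtModel T₀ K M ∧
        ∀ D ∈ G, Clause.Holds M a D) ↔
      ¬ ∃ (M : Structure (L.extend E)) (a : Assignment M C), M.reduct.IsModel T₀ ∧
        (∀ D ∈ instances K (est K G), Clause.Holds M a D) ∧ ∀ D ∈ G, Clause.Holds M a D)

/-- `ψ` is a `T₀ ∪ K`-general uniform interpolant, with respect to the extension symbols `Fs` and
the constants `Cs`, of the conjunction of the ground `Π^C`-formulas in `Φ`. -/
def IsGeneralUniformInterpolant (T₀ : Set (Sentence L))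
    (K : Set (Clause (L.extend E) (Var (S := S)))) (Φ : Set (QFFormula (L.extend E) C))
    (Fs : Set E.Func) (Cs : Set (Sigma C)) (ψ : QFFormula (L.extend E) C) : Prop :=
  (ψ.extFuncs ⊆ Fs ∧ ψ.vars ⊆ Cs) ∧
  Entails T₀ K Φ ψ ∧
  ∀ θ : QFFormula (L.extend E) C,
    (∀ f ∈ θ.extFuncs, (∃ φ ∈ Φ, f ∈ φ.extFuncs) → f ∈ Fs) →
    (∀ c ∈ θ.vars, (∃ φ ∈ Φ, c ∈ φ.vars) → c ∈ Cs) →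
    Entails T₀ K Φ θ → Entails T₀ K {ψ} θ

/-! ### The algorithm for function elimination -/

/-- The constants of the purified problem: those in `C`, and for every extension term `t` a new
constant `c_t`, which is named by `t` itself. -/
abbrev PConst (L : Signature S) (E : ExtSymbols S) (C : S → Type u) (s : S) : Type u :=
  C s ⊕ Term (L.extend E) C s

/-- Purification: every maximal extension subterm `t` is replaced by the constant `c_t`. -/
def Term.purify : {s : S} → Term (L.extend E) C s → Term L (PConst L E C) s
  | _, .var c => .var (Sum.inl c)
  | _, .func (Sum.inl f) ts => .func (L := L) f (fun i => (ts i).purify)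
  | _, .func (Sum.inr f) ts => .var (Sum.inr (extApp f ts))

def Literal.purify : Literal (L.extend E) C → Literal L (PConst L E C)
  | .eq b t t' => .eq b t.purify t'.purify
  | .rel b P ts => .rel (L := L) b P (fun i => (ts i).purify)

def Clause.purify (D : Clause (L.extend E) C) : Clause L (PConst L E C) :=
  D.map Literal.purify

/-- For `t = f(c₁, …, cₙ)` and `t' = f(d₁, …, dₙ)` the congruence clause
`c₁ ≈ d₁ ∧ … ∧ cₙ ≈ dₙ → c_t ≈ c_t'` (nested extension terms being purified too). -/
def congruenceClause (f : E.Func) (ts ts' : ExtArgs L E C f) :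
    Clause L (PConst L E C) :=
  List.append
    (List.ofFn fun i => (Literal.eq false (ts i).purify (ts' i).purify :
      Literal L (PConst L E C)))
    [Literal.eq true (.var (Sum.inr (extApp f ts))) (.var (Sum.inr (extApp f ts')))]

/-- `Con₀`, for the definitions `c_t ≈ t` of the extension terms `t` that occur in `N`. -/
def Con₀ (N : Set (Clause (L.extend E) C)) : Set (Clause L (PConst L E C)) :=
  {D | ∃ (f : E.Func) (ts ts' : ExtArgs L E C f),
    ⟨E.cod f, extApp f ts⟩ ∈ extTerms N ∧
    ⟨E.cod f, extApp f ts'⟩ ∈ extTerms N ∧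
    D = congruenceClause f ts ts'}

/-- The constants that are kept, for the shared symbols `Fs` and `Cs`: the constants in `Cs`, the
constants `c_t` for the occurring terms `t` that start with a symbol in `Fs`, and the constants
that occur as arguments of symbols in `Fs`. -/
def keptConsts (Fs : Set E.Func) (Cs : Set (Sigma C)) (N : Set (Clause (L.extend E) C)) :
    Set (Sigma (PConst L E C)) :=
  {p | ∃ c ∈ Cs, p = ⟨c.1, Sum.inl c.2⟩} ∪
  {p | ∃ t ∈ extTerms N, HasRootIn Fs t ∧ p = ⟨t.1, Sum.inr t.2⟩} ∪
  {p | ∃ (f : E.Func) (ts : ExtArgs L E C f), f ∈ Fs ∧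
    ⟨E.cod f, extApp f ts⟩ ∈ extTerms N ∧
    ∃ i, p ∈ (ts i).purify.vars}

/-- Replacing the constants `c_t` back by `t`, in terms. -/
def Term.unpurify : {s : S} → Term L (PConst L E C) s → Term (L.extend E) C s
  | _, .var (Sum.inl c) => .var c
  | _, .var (Sum.inr t) => t
  | _, .func f ts => .func (L := L.extend E) (Sum.inl f) (fun i => (ts i).unpurify)

/-- Replacing the constants `c_t` back by `t`, in quantifier-free formulas. -/
def QFFormula.unpurify : QFFormula L (PConst L E C) → QFFormula (L.extend E) C
  | .falsum => .falsum
  | .eq t t' => .eq t.unpurify t'.unpurify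
  | .rel P ts => .rel (L := L.extend E) P (fun i => (ts i).unpurify)
  | .imp φ ψ => .imp φ.unpurify ψ.unpurify

/-- `Γ` is an output of the algorithm for function elimination, run on the extension `T₀ ∪ K`, the
ground clauses `G` and the set of terms `T`, for the shared symbols `Fs` and `Cs`.
With `N = K[T] ∪ G` and `G₁ = K₀ ∪ G₀ ∪ Con₀`, the formula `Γ₁` is a quantifier-free formula over
the kept constants that is equivalent modulo `T₀` to `∃ x̄, G₁`, where the existential quantifiers
bind all constants that are not kept; `Γ` results from `Γ₁` by replacing back. -/
def IsAlgorithmOutput (T₀ : Set (Sentence L)) (K : Set (Clause (L.extend E) (Var (S := S))))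
    (G : Set (Clause (L.extend E) C)) (T : Set (Sigma (Term (L.extend E) C)))
    (Fs : Set E.Func) (Cs : Set (Sigma C)) (Γ : QFFormula (L.extend E) C) : Prop :=
  let N := instances K T ∪ G
  let G₁ : Set (Clause L (PConst L E C)) := Clause.purify '' N ∪ Con₀ N
  ∃ Γ₁ : QFFormula L (PConst L E C),
    Γ₁.vars ⊆ keptConsts Fs Cs N ∧
    (∀ (M : Structure L) (a : Assignment M (PConst L E C)), M.IsModel T₀ →
      (Γ₁.Holds M a ↔ ∃ b : Assignment M (PConst L E C),
        (∀ p ∈ keptConsts Fs Cs N, b p.1 p.2 = a p.1 p.2) ∧ ∀ D ∈ G₁, Clause.Holds M b D)) ∧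
    Γ = Γ₁.unpurify

/-- The constants in `C` that occur as arguments of symbols in `Fs` in `G`. -/
def argConsts (Fs : Set E.Func) (G : Set (Clause (L.extend E) C)) : Set (Sigma C) :=
  {c | ∃ (f : E.Func) (ts : ExtArgs L E C f), f ∈ Fs ∧
    ⟨E.cod f, extApp f ts⟩ ∈ extTerms G ∧
    ∃ i, (⟨_, ts i⟩ : Sigma (Term (L.extend E) C)) = ⟨c.1, .var c.2⟩}

end Extensions

end MSL

open MSL

/-! An output exists because everything the algorithm handles is finite. Up to its irrelevant values
elsewhere, a substitution that produces an instance in `K[T]` sends each variable of the clause to a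
subterm of a term in `T`, since each variable lies below an extension symbol (`instances_finite`).
So `G₁` is a finite set of clauses, and the constants that are not kept can be eliminated
(`AllowsQE.exists_eliminant`). The output is entailed by `G` because, in a model of `T₀ ∪ K ∪ G`,
interpreting each `c_t` as the value of `t` satisfies `G₁` (`IsAlgorithmOutput.entails`).

The heart of the uniform interpolation property is `IsAlgorithmOutput.isGeneralUniformInterpolant`.
Suppose `G` entails `θ`, yet some model `M` of `T₀ ∪ K` with constants `a` satisfies `Γ` and refutes
`θ`. Truth of `Γ` yields an assignment `b` of the purified constants that satisfies `G₁` and agrees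
with `M` and `a` on the kept ones. Let `M'` be `M` with the functions of `F₁` redefined so that each
occurring `F₁`-term `t` takes the value `b` gives to `c_t`; the clauses in `Con₀` make this
consistent. Let the constants of `G` take their values from `b`. Then `G` and the selected instances
hold in `M'`. Still `θ` fails there: every symbol of `F₁` occurs in `G`, so `θ` contains none, and
the constants it shares with `G` have kept their values.

The clauses of `K₁` may be false in `M'` at points that no term names, and here locality helps. It
is applied to `G` together with clauses for the negation of `θ`. As `θ` adds no `F₁`-terms, every
instance of `K₁` that locality demands is already one of the selected instances; the clauses of `Ks`
and `Ki` do not mention `F₁` and remain true as in `M`. So `G` and the negation of `θ` have a common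
model over `T₀ ∪ K`, a contradiction.

Flatness and linearity enter through `IsShallow`: all terms of `est K G` have arguments that are
additional constants or nullary base symbols. Hence no extension terms are nested, and the symbols
of the output can be read off (`IsAlgorithmOutput.symbols`). -/

namespace MSL

variable {S : Type u}

/-! ### Subterms, symbols, and dependence of truth on the occurring symbols -/

section TermsAndClauses

variable {L : Signature S} {X : S → Type v}

/-- The root symbol of a term together with its arguments. -/
def Term.root : {s : S} → Term L X s →
    Option ((f : L.Func) × ((i : Fin (L.dom f).length) → Term L X ((L.dom f).get i)))
  | _, .var _ => none
  | _, .func f ts => some ⟨f, ts⟩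

/-- The sorts `L.cod f` and `L.cod g` are not free indices, so case analysis on the equality is
blocked; `Term.root` has a type that does not depend on the sort and can simply be applied to both
sides. -/
theorem Term.func_inj {f g : L.Func} {ts : (i : Fin (L.dom f).length) → Term L X ((L.dom f).get i)}
    {us : (i : Fin (L.dom g).length) → Term L X ((L.dom g).get i)}
    (h : (⟨_, .func f ts⟩ : Sigma (Term L X)) = ⟨_, .func g us⟩) :
    (⟨f, ts⟩ : (f : L.Func) × ((i : Fin (L.dom f).length) → Term L X ((L.dom f).get i))) =
      ⟨g, us⟩ := by
  have := congrArg (fun t : Sigma (Term L X) => t.2.root) h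
  simpa only [Term.root, Option.some.injEq] using this

theorem Term.var_ne_func {s : S} {x : X s} {f : L.Func}
    {ts : (i : Fin (L.dom f).length) → Term L X ((L.dom f).get i)} :
    (⟨s, .var x⟩ : Sigma (Term L X)) ≠ ⟨_, .func f ts⟩ := by
  intro h
  have := congrArg (fun t : Sigma (Term L X) => t.2.root) h
  simp [Term.root] at this

theorem Term.var_inj {s r : S} {x : X s} {y : X r}
    (h : (⟨s, .var x⟩ : Sigma (Term L X)) = ⟨r, .var y⟩) :
    (⟨s, x⟩ : Sigma X) = ⟨r, y⟩ := by
  cases h; rfl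

theorem Term.mem_subterms_self {s : S} (t : Term L X s) :
    (⟨s, t⟩ : Sigma (Term L X)) ∈ t.subterms := by
  cases t <;> simp [Term.subterms]

theorem Term.mem_subterms_func {f : L.Func}
    {ts : (i : Fin (L.dom f).length) → Term L X ((L.dom f).get i)} {u : Sigma (Term L X)} :
    u ∈ (Term.func f ts).subterms ↔ u = ⟨_, .func f ts⟩ ∨ ∃ i, u ∈ (ts i).subterms := by
  simp [Term.subterms]

theorem Term.mem_subterms_var {s : S} {x : X s} {u : Sigma (Term L X)} :
    u ∈ (Term.var x : Term L X s).subterms ↔ u = ⟨s, .var x⟩ := by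
  simp [Term.subterms]

theorem Term.subterms_trans {s : S} {t : Term L X s} {u : Sigma (Term L X)}
    (hu : u ∈ t.subterms) {w : Sigma (Term L X)} (hw : w ∈ u.2.subterms) : w ∈ t.subterms := by
  induction t with
  | var x =>
    rw [Term.mem_subterms_var] at hu
    subst hu
    exact hw
  | func f ts ih =>
    rw [Term.mem_subterms_func] at hu
    rcases hu with rfl | ⟨i, hi⟩
    · exact hw
    · exact Term.mem_subterms_func.2 (Or.inr ⟨i, ih i hi⟩)

theorem Term.subterms_finite {s : S} (t : Term L X s) : t.subterms.Finite := by
  induction t with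
  | var x => exact Set.finite_singleton _
  | func f ts ih => exact (Set.finite_singleton _).union (Set.finite_iUnion ih)

theorem Term.vars_var {s : S} (x : X s) : (Term.var x : Term L X s).vars = {⟨s, x⟩} := by
  ext y
  simp only [Term.vars, Set.mem_ofPred_eq, Term.mem_subterms_var, Set.mem_singleton_iff]
  constructor
  · exact Term.var_inj
  · rintro rfl; rfl

theorem Term.vars_func (f : L.Func)
    (ts : (i : Fin (L.dom f).length) → Term L X ((L.dom f).get i)) :
    (Term.func f ts).vars = ⋃ i, (ts i).vars := by
  ext y
  simp only [Term.vars, Set.mem_ofPred_eq, Term.mem_subterms_func, Set.mem_iUnion]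
  exact or_iff_right Term.var_ne_func

theorem Term.mem_funcs_func {f g : L.Func}
    {ts : (i : Fin (L.dom f).length) → Term L X ((L.dom f).get i)} :
    g ∈ (Term.func f ts).funcs ↔ g = f ∨ ∃ i, g ∈ (ts i).funcs := by
  simp only [Term.funcs, Set.mem_ofPred_eq, Term.mem_subterms_func]
  constructor
  · rintro ⟨us, h | ⟨i, h⟩⟩
    · exact Or.inl (congrArg Sigma.fst (Term.func_inj h))
    · exact Or.inr ⟨i, us, h⟩
  · rintro (rfl | ⟨i, us, h⟩)
    · exact ⟨ts, Or.inl rfl⟩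
    · exact ⟨us, Or.inr ⟨i, h⟩⟩

theorem Term.vars_finite {s : S} (t : Term L X s) : t.vars.Finite := by
  induction t with
  | var x => rw [Term.vars_var]; exact Set.finite_singleton _
  | func f ts ih => rw [Term.vars_func]; exact Set.finite_iUnion ih

/-- The structure `M` with its functions replaced by `fn`. -/
def Structure.withFn (M : Structure L) (fn : (f : L.Func) →
    ((i : Fin (L.dom f).length) → M.carrier ((L.dom f).get i)) → M.carrier (L.cod f)) :
    Structure L where
  carrier := M.carrier
  nonempty := M.nonempty
  fn := fn
  rel := M.rel

theorem Term.eval_congr {M : Structure L} {fn : (f : L.Func) →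
      ((i : Fin (L.dom f).length) → M.carrier ((L.dom f).get i)) → M.carrier (L.cod f)}
    {a b : Assignment M X} {s : S} {t : Term L X s} (hf : ∀ f ∈ t.funcs, fn f = M.fn f)
    (hab : ∀ x ∈ t.vars, a x.1 x.2 = b x.1 x.2) :
    t.eval (M.withFn fn) a = t.eval M b := by
  induction t with
  | var x => exact hab ⟨_, x⟩ (by simp [Term.vars_var])
  | func f ts ih =>
    have h : ∀ i, (ts i).eval (M.withFn fn) a = (ts i).eval M b := fun i => ih i
      (fun g hg => hf g (Term.mem_funcs_func.2 (Or.inr ⟨i, hg⟩)))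
      (fun x hx => hab x (by rw [Term.vars_func]; exact Set.mem_iUnion.2 ⟨i, hx⟩))
    change fn f (fun i => (ts i).eval (M.withFn fn) a) = M.fn f (fun i => (ts i).eval M b)
    rw [hf f (Term.mem_funcs_func.2 (Or.inl rfl))]
    exact congrArg _ (funext h)

/-- Functions and valuation change simultaneously, as they do in the countermodel for uniform
interpolation. With `fn := M.fn` this is dependence on the values of the occurring variables alone.
-/
theorem QFFormula.holds_congr {M : Structure L} {fn : (f : L.Func) →
      ((i : Fin (L.dom f).length) → M.carrier ((L.dom f).get i)) → M.carrier (L.cod f)}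
    {a b : Assignment M X} {φ : QFFormula L X} (hf : ∀ f ∈ φ.funcs, fn f = M.fn f)
    (hab : ∀ x ∈ φ.vars, a x.1 x.2 = b x.1 x.2) :
    φ.Holds (M.withFn fn) a ↔ φ.Holds M b := by
  induction φ with
  | falsum => exact Iff.rfl
  | eq t t' =>
    have h := Term.eval_congr (t := t) (fun f h => hf f (Or.inl h)) (fun x h => hab x (Or.inl h))
    have h' := Term.eval_congr (t := t') (fun f h => hf f (Or.inr h))
      (fun x h => hab x (Or.inr h))
    change t.eval (M.withFn fn) a = t'.eval (M.withFn fn) a ↔ t.eval M b = t'.eval M b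
    exact iff_of_eq (congrArg₂ (· = ·) h h')
  | rel P ts =>
    have h : ∀ i, (ts i).eval (M.withFn fn) a = (ts i).eval M b := fun i => Term.eval_congr
      (fun f h => hf f (Set.mem_iUnion.2 ⟨i, h⟩)) (fun x h => hab x (Set.mem_iUnion.2 ⟨i, h⟩))
    exact iff_of_eq (congrArg (M.rel P) (funext h))
  | imp φ ψ ih ih' =>
    exact imp_congr (ih (fun f h => hf f (Or.inl h)) (fun x h => hab x (Or.inl h)))
      (ih' (fun f h => hf f (Or.inr h)) (fun x h => hab x (Or.inr h)))

theorem QFFormula.vars_finite (φ : QFFormula L X) : φ.vars.Finite := by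
  induction φ with
  | falsum => exact Set.finite_empty
  | eq t t' => exact t.vars_finite.union t'.vars_finite
  | rel P ts => exact Set.finite_iUnion fun i => (ts i).vars_finite
  | imp φ ψ ih ih' => exact ih.union ih'

/-! ### Substitution -/

variable {Y : S → Type w}

theorem Term.subst_congr {σ τ : (s : S) → X s → Term L Y s} {s : S} {t : Term L X s}
    (h : ∀ x ∈ t.vars, σ x.1 x.2 = τ x.1 x.2) : t.subst σ = t.subst τ := by
  induction t with
  | var x => exact h ⟨_, x⟩ (by simp [Term.vars_var])
  | func f ts ih =>
    exact congrArg (Term.func f) (funext fun i => ih i fun x hx =>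
      h x (by rw [Term.vars_func]; exact Set.mem_iUnion.2 ⟨i, hx⟩))

theorem Term.eval_subst {M : Structure L} {a : Assignment M Y}
    {σ : (s : S) → X s → Term L Y s} {s : S} (t : Term L X s) :
    (t.subst σ).eval M a = t.eval M (fun s x => (σ s x).eval M a) := by
  induction t with
  | var x => rfl
  | func f ts ih => exact congrArg (M.fn f) (funext ih)

theorem Term.subst_mem_subterms {σ : (s : S) → X s → Term L Y s} {s : S} {t : Term L X s}
    {u : Sigma (Term L X)} (hu : u ∈ t.subterms) :
    (⟨u.1, u.2.subst σ⟩ : Sigma (Term L Y)) ∈ (t.subst σ).subterms := by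
  induction t with
  | var x =>
    rw [Term.mem_subterms_var] at hu
    subst hu
    exact Term.mem_subterms_self _
  | func f ts ih =>
    rw [Term.mem_subterms_func] at hu
    rcases hu with rfl | ⟨i, hi⟩
    · exact Term.mem_subterms_self _
    · exact Term.mem_subterms_func.2 (Or.inr ⟨i, ih i hi⟩)

/-- A subterm of `tσ` comes from a function application in `t`, or lies in some `xσ`. -/
theorem Term.mem_subterms_subst {σ : (s : S) → X s → Term L Y s} {s : S} {t : Term L X s}
    {u : Sigma (Term L Y)} (hu : u ∈ (t.subst σ).subterms) :
    (∃ f ts, (⟨_, .func f ts⟩ : Sigma (Term L X)) ∈ t.subterms ∧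
      u = ⟨_, (Term.func f ts).subst σ⟩) ∨
    ∃ x ∈ t.vars, u ∈ (σ x.1 x.2).subterms := by
  induction t with
  | var x => exact Or.inr ⟨⟨_, x⟩, by simp [Term.vars_var], hu⟩
  | func f ts ih =>
    rcases Term.mem_subterms_func.1 hu with h | ⟨i, hi⟩
    · exact Or.inl ⟨f, ts, Term.mem_subterms_self _, h⟩
    · rcases ih i hi with ⟨g, us, h, h'⟩ | ⟨x, hx, h⟩
      · exact Or.inl ⟨g, us, Term.mem_subterms_func.2 (Or.inr ⟨i, h⟩), h'⟩
      · exact Or.inr ⟨x, by rw [Term.vars_func]; exact Set.mem_iUnion.2 ⟨i, hx⟩, h⟩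

theorem Term.mem_vars_subst {σ : (s : S) → X s → Term L Y s} {s : S} {t : Term L X s}
    {y : Sigma Y} (hy : y ∈ (t.subst σ).vars) : ∃ x ∈ t.vars, y ∈ (σ x.1 x.2).vars := by
  rcases Term.mem_subterms_subst hy with ⟨f, ts, -, h⟩ | h
  · exact absurd h Term.var_ne_func
  · exact h

/-! ### Literals and clauses -/

theorem Clause.holds_iff {M : Structure L} {a : Assignment M X} {D : Clause L X} :
    Clause.Holds M a D ↔ ∃ l ∈ D, (Literal.toQF l).Holds M a := by
  induction D with
  | nil => simp [Clause.Holds, Clause.toQF, QFFormula.Holds]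
  | cons l D ih =>
    have : Clause.Holds M a (l :: D) ↔ (¬ (Literal.toQF l).Holds M a → Clause.Holds M a D) :=
      Iff.rfl
    rw [this, ih]
    simp only [List.mem_cons, exists_eq_or_imp]
    tauto

theorem Literal.holds_subst {M : Structure L} {a : Assignment M Y}
    {σ : (s : S) → X s → Term L Y s} (l : Literal L X) :
    (l.subst σ).toQF.Holds M a ↔ l.toQF.Holds M (fun s x => (σ s x).eval M a) := by
  rcases l with ⟨_ | _, t, t'⟩ | ⟨_ | _, P, ts⟩ <;>
    simp [Literal.subst, Literal.toQF, QFFormula.neg, QFFormula.Holds, Term.eval_subst]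

theorem Clause.holds_subst {M : Structure L} {a : Assignment M Y}
    {σ : (s : S) → X s → Term L Y s} (D : Clause L X) :
    Clause.Holds M a (Clause.subst σ D) ↔ Clause.Holds M (fun s x => (σ s x).eval M a) D := by
  simp [Clause.holds_iff, Clause.subst, Literal.holds_subst]

theorem Clause.subterms_trans {D : Clause L X} {u w : Sigma (Term L X)}
    (hu : u ∈ Clause.subterms D) (hw : w ∈ u.2.subterms) : w ∈ Clause.subterms D := by
  obtain ⟨l, hl, h⟩ := hu
  refine ⟨l, hl, ?_⟩
  rcases l with ⟨_, t, t'⟩ | ⟨_, P, ts⟩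
  · exact h.imp (fun h => Term.subterms_trans h hw) (fun h => Term.subterms_trans h hw)
  · obtain ⟨i, hi⟩ := Set.mem_iUnion.1 h
    exact Set.mem_iUnion.2 ⟨i, Term.subterms_trans hi hw⟩

theorem Literal.subterms_finite (l : Literal L X) : l.subterms.Finite := by
  rcases l with ⟨_, t, t'⟩ | ⟨_, P, ts⟩
  · exact t.subterms_finite.union t'.subterms_finite
  · exact Set.finite_iUnion fun i => (ts i).subterms_finite

theorem Clause.subterms_finite (D : Clause L X) : (Clause.subterms D).Finite := by
  have : Clause.subterms D = ⋃ l ∈ {l | l ∈ D}, Literal.subterms l := by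
    ext t; simp [Clause.subterms]
  rw [this]
  exact (List.finite_toSet D).biUnion fun l _ => l.subterms_finite

theorem Clause.vars_finite (D : Clause L X) : (Clause.vars D).Finite := by
  refine (Clause.subterms_finite D).preimage (f := fun x : Sigma X => ⟨x.1, .var x.2⟩) ?_
  rintro ⟨s, x⟩ - ⟨r, y⟩ - h
  exact Term.var_inj h

theorem Literal.subst_congr {σ τ : (s : S) → X s → Term L Y s} {l : Literal L X}
    (h : ∀ x : Sigma X, (⟨x.1, .var x.2⟩ : Sigma (Term L X)) ∈ l.subterms →
      σ x.1 x.2 = τ x.1 x.2) : l.subst σ = l.subst τ := by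
  rcases l with ⟨b, t, t'⟩ | ⟨b, P, ts⟩
  · exact congrArg₂ (Literal.eq b) (Term.subst_congr fun x hx => h x (Or.inl hx))
      (Term.subst_congr fun x hx => h x (Or.inr hx))
  · exact congrArg (Literal.rel b P) (funext fun i => Term.subst_congr fun x hx =>
      h x (Set.mem_iUnion.2 ⟨i, hx⟩))

theorem Clause.subst_congr {σ τ : (s : S) → X s → Term L Y s} {D : Clause L X}
    (h : ∀ x ∈ Clause.vars D, σ x.1 x.2 = τ x.1 x.2) : Clause.subst σ D = Clause.subst τ D :=
  List.map_congr_left fun l hl => Literal.subst_congr fun x hx => h x ⟨l, hl, hx⟩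

theorem Clause.subst_mem_subterms {σ : (s : S) → X s → Term L Y s} {D : Clause L X}
    {u : Sigma (Term L X)} (hu : u ∈ Clause.subterms D) :
    (⟨u.1, u.2.subst σ⟩ : Sigma (Term L Y)) ∈ Clause.subterms (Clause.subst σ D) := by
  obtain ⟨l, hl, h⟩ := hu
  refine ⟨l.subst σ, List.mem_map_of_mem hl, ?_⟩
  rcases l with ⟨_, t, t'⟩ | ⟨_, P, ts⟩
  · exact h.imp Term.subst_mem_subterms Term.subst_mem_subterms
  · obtain ⟨i, hi⟩ := Set.mem_iUnion.1 h
    exact Set.mem_iUnion.2 ⟨i, Term.subst_mem_subterms hi⟩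

theorem Clause.mem_subterms_subst {σ : (s : S) → X s → Term L Y s} {D : Clause L X}
    {u : Sigma (Term L Y)} (hu : u ∈ Clause.subterms (Clause.subst σ D)) :
    (∃ f ts, (⟨_, .func f ts⟩ : Sigma (Term L X)) ∈ Clause.subterms D ∧
      u = ⟨_, (Term.func f ts).subst σ⟩) ∨
    ∃ x ∈ Clause.vars D, u ∈ (σ x.1 x.2).subterms := by
  obtain ⟨l', hl', h⟩ := hu
  obtain ⟨l, hl, rfl⟩ := List.mem_map.1 hl'
  have key : ∃ t : Sigma (Term L X), t.2.subterms ⊆ l.subterms ∧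
      u ∈ (t.2.subst σ).subterms := by
    rcases l with ⟨_, t, t'⟩ | ⟨_, P, ts⟩
    · rcases h with h | h
      · exact ⟨⟨_, t⟩, Set.subset_union_left, h⟩
      · exact ⟨⟨_, t'⟩, Set.subset_union_right, h⟩
    · obtain ⟨i, hi⟩ := Set.mem_iUnion.1 h
      exact ⟨⟨_, ts i⟩, Set.subset_iUnion (fun i => (ts i).subterms) i, hi⟩
  obtain ⟨t, ht, hu⟩ := key
  rcases Term.mem_subterms_subst hu with ⟨f, ts, h, h'⟩ | ⟨x, hx, h'⟩
  · exact Or.inl ⟨f, ts, ⟨l, hl, ht h⟩, h'⟩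
  · exact Or.inr ⟨x, ⟨l, hl, ht hx⟩, h'⟩

theorem Literal.vars_toQF (l : Literal L X) :
    l.toQF.vars = {x | (⟨x.1, .var x.2⟩ : Sigma (Term L X)) ∈ l.subterms} := by
  ext x
  rcases l with ⟨_ | _, t, t'⟩ | ⟨_ | _, P, ts⟩ <;>
    simp [Literal.toQF, QFFormula.neg, QFFormula.vars, Literal.subterms, Term.vars]

theorem Literal.funcs_toQF (l : Literal L X) :
    l.toQF.funcs = {f | ∃ ts, (⟨_, .func f ts⟩ : Sigma (Term L X)) ∈ l.subterms} := by
  ext x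
  rcases l with ⟨_ | _, t, t'⟩ | ⟨_ | _, P, ts⟩ <;>
    simp [Literal.toQF, QFFormula.neg, QFFormula.funcs, Literal.subterms, Term.funcs,
      exists_or, exists_comm (α := Fin _)]

theorem Clause.mem_vars_toQF {D : Clause L X} {x : Sigma X} :
    x ∈ (Clause.toQF D).vars ↔ x ∈ Clause.vars D := by
  induction D with
  | nil => simp [Clause.toQF, QFFormula.vars, Clause.vars, Clause.subterms]
  | cons l D ih =>
    have : (Clause.toQF (l :: D)).vars = l.toQF.vars ∪ ∅ ∪ (Clause.toQF D).vars := rfl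
    rw [this, Set.mem_union, ih, Literal.vars_toQF]
    simp [Clause.vars, Clause.subterms]

theorem Clause.mem_funcs_toQF {D : Clause L X} {f : L.Func} :
    f ∈ (Clause.toQF D).funcs ↔
      ∃ ts, (⟨_, .func f ts⟩ : Sigma (Term L X)) ∈ Clause.subterms D := by
  induction D with
  | nil => simp [Clause.toQF, QFFormula.funcs, Clause.subterms]
  | cons l D ih =>
    have : (Clause.toQF (l :: D)).funcs = l.toQF.funcs ∪ ∅ ∪ (Clause.toQF D).funcs := rfl
    rw [this, Set.mem_union, ih, Literal.funcs_toQF]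
    simp [Clause.subterms, exists_or]

/-! ### Clause normal form -/

/-- Conjunctive normal form of a quantifier-free formula (`true`) or of its negation (`false`). -/
def QFFormula.cnf : Bool → QFFormula L X → List (Clause L X)
  | true, .falsum => [[]]
  | false, .falsum => []
  | b, .eq t t' => [[.eq b t t']]
  | b, .rel P ts => [[.rel b P ts]]
  | true, .imp φ ψ => (φ.cnf false).flatMap fun D => (ψ.cnf true).map fun D' => D ++ D'
  | false, .imp φ ψ => φ.cnf true ++ ψ.cnf false

theorem QFFormula.holds_cnf {M : Structure L} {a : Assignment M X} (φ : QFFormula L X) :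
    ((∀ D ∈ φ.cnf true, Clause.Holds M a D) ↔ φ.Holds M a) ∧
      ((∀ D ∈ φ.cnf false, Clause.Holds M a D) ↔ ¬ φ.Holds M a) := by
  induction φ with
  | falsum => simp [QFFormula.cnf, QFFormula.Holds, Clause.holds_iff]
  | eq t t' => simp [QFFormula.cnf, QFFormula.Holds, Clause.holds_iff, Literal.toQF, neg]
  | rel P ts => simp [QFFormula.cnf, QFFormula.Holds, Clause.holds_iff, Literal.toQF, neg]
  | imp φ ψ ih ih' =>
    constructor
    · have h : ∀ D D' : Clause L X, Clause.Holds M a (D ++ D') ↔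
          Clause.Holds M a D ∨ Clause.Holds M a D' := by
        intro D D'
        simp only [Clause.holds_iff, List.mem_append, or_and_right, exists_or]
      have h2 : (∀ D ∈ (QFFormula.imp φ ψ).cnf true, Clause.Holds M a D) ↔
          (∀ D ∈ φ.cnf false, Clause.Holds M a D) ∨ ∀ D ∈ ψ.cnf true, Clause.Holds M a D := by
        simp only [QFFormula.cnf, List.mem_flatMap, List.mem_map]
        constructor
        · intro H
          -- If each side had a false clause, the concatenation of the two would be a false clause
          -- of the distributed form.
          by_contra! hc
          obtain ⟨⟨D, hD, h1⟩, D', hD', h1'⟩ := hc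
          exact ((h _ _).1 (H _ ⟨D, hD, D', hD', rfl⟩)).elim h1 h1'
        · rintro H _ ⟨D, hD, D', hD', rfl⟩
          exact (h _ _).2 (H.imp (fun H => H D hD) (fun H => H D' hD'))
      rw [h2, ih.2, ih'.1]
      exact imp_iff_not_or.symm
    · have h2 : (∀ D ∈ (QFFormula.imp φ ψ).cnf false, Clause.Holds M a D) ↔
          (∀ D ∈ φ.cnf true, Clause.Holds M a D) ∧ ∀ D ∈ ψ.cnf false, Clause.Holds M a D := by
        simp only [QFFormula.cnf, List.mem_append, or_imp, forall_and]
      rw [h2, ih.1, ih'.2]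
      exact Classical.not_imp.symm

theorem QFFormula.funcs_cnf {φ : QFFormula L X} {b : Bool} {D : Clause L X} (hD : D ∈ φ.cnf b)
    {f : L.Func} {ts : (i : Fin (L.dom f).length) → Term L X ((L.dom f).get i)}
    (h : (⟨_, .func f ts⟩ : Sigma (Term L X)) ∈ Clause.subterms D) : f ∈ φ.funcs := by
  induction φ generalizing b D with
  | falsum =>
    cases b
    · simp [QFFormula.cnf] at hD
    · simp only [QFFormula.cnf, List.mem_singleton] at hD
      subst hD
      simp [Clause.subterms] at h
  | eq t t' =>
    have hD : D = [.eq b t t'] := by cases b <;> simpa [QFFormula.cnf] using hD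
    subst hD
    have h : (⟨_, .func f ts⟩ : Sigma (Term L X)) ∈ (Literal.eq b t t').subterms := by
      simpa [Clause.subterms] using h
    exact h.imp (fun h => ⟨ts, h⟩) (fun h => ⟨ts, h⟩)
  | rel P us =>
    have hD : D = [.rel b P us] := by cases b <;> simpa [QFFormula.cnf] using hD
    subst hD
    have h : (⟨_, .func f ts⟩ : Sigma (Term L X)) ∈ (Literal.rel b P us).subterms := by
      simpa [Clause.subterms] using h
    obtain ⟨i, hi⟩ := Set.mem_iUnion.1 h
    exact Set.mem_iUnion.2 ⟨i, ts, hi⟩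
  | imp φ ψ ih ih' =>
    cases b
    · simp only [QFFormula.cnf, List.mem_append] at hD
      exact hD.imp (fun hD => ih hD h) (fun hD => ih' hD h)
    · simp only [QFFormula.cnf, List.mem_flatMap, List.mem_map] at hD
      obtain ⟨D₁, h₁, D₂, h₂, rfl⟩ := hD
      obtain ⟨l, hl, hl'⟩ := h
      exact (List.mem_append.1 hl).imp (fun hl => ih h₁ ⟨l, hl, hl'⟩)
        (fun hl => ih' h₂ ⟨l, hl, hl'⟩)

end TermsAndClauses

/-! ### Quantifier elimination for finite sets of clauses -/

section Elimination

variable {L : Signature S} {X : S → Type v}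

/-- A quantifier-free formula as a formula. -/
def QFFormula.toFormula : QFFormula L X → Formula L X
  | .falsum => .falsum
  | .eq t t' => .eq t t'
  | .rel P ts => .rel P ts
  | .imp φ ψ => .imp φ.toFormula ψ.toFormula

theorem QFFormula.holds_toFormula {M : Structure L} {a : Assignment M X} (φ : QFFormula L X) :
    φ.toFormula.Holds M a ↔ φ.Holds M a := by
  induction φ with
  | falsum => exact Iff.rfl
  | eq t t' => exact Iff.rfl
  | rel P ts => exact Iff.rfl
  | imp φ ψ ih ih' => exact imp_congr ih ih'

theorem QFFormula.freeVars_toFormula (φ : QFFormula L X) : φ.toFormula.freeVars = φ.vars := by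
  induction φ with
  | falsum => rfl
  | eq t t' => rfl
  | rel P ts => rfl
  | imp φ ψ ih ih' => exact congrArg₂ (· ∪ ·) ih ih'

/-- Conjunction of a finite set of clauses. -/
theorem exists_conj {Q : Set (Clause L X)} (hQ : Q.Finite) : ∃ φ : QFFormula L X,
    ∀ (M : Structure L) (a : Assignment M X), φ.Holds M a ↔ ∀ D ∈ Q, Clause.Holds M a D := by
  induction Q, hQ using Set.Finite.induction_on with
  | empty => exact ⟨.imp .falsum .falsum, fun M a => by simp [QFFormula.Holds]⟩
  | @insert D Q _ _ ih =>
    obtain ⟨φ, hφ⟩ := ih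
    refine ⟨(QFFormula.imp (Clause.toQF D) φ.neg).neg, fun M a => ?_⟩
    have : (QFFormula.imp (Clause.toQF D) φ.neg).neg.Holds M a ↔
        ¬ (Clause.Holds M a D → ¬ φ.Holds M a) := Iff.rfl
    rw [this, hφ]
    simp only [Set.mem_insert_iff, forall_eq_or_imp]
    tauto

/-- Existential quantification over a list of variables. -/
theorem exists_exs (φ : Formula L X) (l : List (Sigma X)) : ∃ χ : Formula L X,
    χ.freeVars ⊆ φ.freeVars \ {x | x ∈ l} ∧ ∀ (M : Structure L) (a : Assignment M X),
      χ.Holds M a ↔ ∃ b : Assignment M X,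
        (∀ p : Sigma X, p ∉ l → b p.1 p.2 = a p.1 p.2) ∧ φ.Holds M b := by
  classical
  induction l with
  | nil =>
    refine ⟨φ, by simp, fun M a => ⟨fun h => ⟨a, fun _ _ => rfl, h⟩, ?_⟩⟩
    rintro ⟨b, hb, h⟩
    rwa [show b = a from funext fun s => funext fun x => hb ⟨s, x⟩ (by simp)] at h
  | cons x l ih =>
    obtain ⟨χ, hχ, h⟩ := ih
    refine ⟨.imp (.all x.2 (.imp χ .falsum)) .falsum, ?_, fun M a => ?_⟩
    · rintro y (⟨hy | hy, hx⟩ | hy)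
      · exact ⟨(hχ hy).1, fun hy' => (List.mem_cons.1 hy').elim hx (hχ hy).2⟩
      · exact hy.elim
      · exact hy.elim
    · have : (Formula.imp (.all x.2 (.imp χ .falsum)) .falsum).Holds M a ↔
          ¬ ∀ c : Assignment M X, (∀ (r : S) (y : X r), (⟨r, y⟩ : Sigma X) ≠ x →
            c r y = a r y) → ¬ χ.Holds M c := Iff.rfl
      rw [this]
      push Not
      constructor
      · rintro ⟨c, hc, hcχ⟩
        obtain ⟨b, hb, hbφ⟩ := (h M c).1 hcχ
        refine ⟨b, fun p hp => ?_, hbφ⟩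
        rw [List.mem_cons, not_or] at hp
        rw [hb p hp.2, hc p.1 p.2 hp.1]
      · rintro ⟨b, hb, hbφ⟩
        -- The witness for the outermost quantifier is the `x`-variant of `a` that takes its value
        -- at `x` from `b`.
        refine ⟨fun s y => if (⟨s, y⟩ : Sigma X) = x then b s y else a s y,
          fun r y hy => if_neg hy, (h M _).2 ⟨b, fun p hp => ?_, hbφ⟩⟩
        by_cases hpx : p = x
        · exact (if_pos hpx).symm
        · rw [hb p (by simp [hpx, hp])]
          exact (if_neg hpx).symm

/-- Elimination of all but the variables in `V` from a finite set of clauses. -/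
theorem AllowsQE.exists_eliminant {X : S → Type u} {T₀ : Set (Sentence L)} (hQE : AllowsQE T₀)
    {Q : Set (Clause L X)} (hQ : Q.Finite) (V : Set (Sigma X)) :
    ∃ ψ : QFFormula L X, ψ.vars ⊆ V ∧ ∀ (M : Structure L) (a : Assignment M X), M.IsModel T₀ →
      (ψ.Holds M a ↔ ∃ b : Assignment M X, (∀ p ∈ V, b p.1 p.2 = a p.1 p.2) ∧
        ∀ D ∈ Q, Clause.Holds M b D) := by
  classical
  obtain ⟨φ, hφ⟩ := exists_conj hQ
  -- All variables outside `V`, possibly infinitely many, are to be eliminated, but only the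
  -- finitely many that occur in `φ` need a quantifier.
  have hfin : (φ.vars \ V).Finite := φ.vars_finite.subset Set.sdiff_subset
  have hl : ∀ x, x ∈ hfin.toFinset.toList ↔ x ∈ φ.vars ∧ x ∉ V := by simp
  obtain ⟨χ, hχ, h⟩ := exists_exs φ.toFormula hfin.toFinset.toList
  obtain ⟨ψ, hψ, h'⟩ := hQE X χ
  refine ⟨ψ, fun x hx => ?_, fun M a hM => ?_⟩
  · obtain ⟨h1, h2⟩ := hχ (hψ hx)
    rw [QFFormula.freeVars_toFormula] at h1
    by_contra hxV
    exact h2 ((hl x).2 ⟨h1, hxV⟩)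
  · rw [← h' M hM a, h M a]
    constructor
    · rintro ⟨b, hb, hbφ⟩
      exact ⟨b, fun p hp => hb p fun hp' => ((hl p).1 hp').2 hp,
        (hφ M b).1 (φ.holds_toFormula.1 hbφ)⟩
    · rintro ⟨b, hb, hbQ⟩
      -- `b` may differ from `a` at variables that are not quantified. Resetting those to `a` does
      -- not affect `φ`: the ones occurring in `φ` lie in `V`, where `b` and `a` agree.
      refine ⟨fun s x => if (⟨s, x⟩ : Sigma X) ∈ hfin.toFinset.toList then b s x else a s x,
        fun p hp => if_neg hp, φ.holds_toFormula.2
          ((QFFormula.holds_congr (fn := M.fn) (fun _ _ => rfl) fun x hx => ?_).2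
            ((hφ M b).2 hbQ))⟩
      by_cases hxl : x ∈ hfin.toFinset.toList
      · exact if_pos hxl
      · rw [hl, not_and, not_not] at hxl
        rw [hb x (hxl hx)]
        exact if_neg fun h => ((hl x).1 h).2 (hxl hx)

end Elimination

section Extensions

variable {L : Signature S} {E : ExtSymbols S}

/-! ### Finiteness -/

theorem extApp_inj {X : S → Type v} {f g : E.Func} {ts : ExtArgs L E X f} {us : ExtArgs L E X g}
    (h : (⟨_, extApp f ts⟩ : Sigma (Term (L.extend E) X)) = ⟨_, extApp g us⟩) :
    (⟨f, ts⟩ : (f : E.Func) × ExtArgs L E X f) = ⟨g, us⟩ := by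
  have h := Term.func_inj (L := L.extend E) (f := Sum.inr f) (g := Sum.inr g) h
  obtain ⟨h1, h2⟩ := Sigma.mk.inj h
  obtain rfl := Sum.inr.inj h1
  exact congrArg _ (eq_of_heq h2)

variable {C : S → Type u}

theorem extTerms_finite {N : Set (Clause (L.extend E) C)} (hN : N.Finite) :
    (extTerms N).Finite :=
  (hN.biUnion fun D _ => Clause.subterms_finite D).subset fun t ht => by
    obtain ⟨-, D, hD, h⟩ := ht
    exact Set.mem_biUnion hD h

theorem Con₀_finite {N : Set (Clause (L.extend E) C)} (hN : N.Finite) : (Con₀ N).Finite := by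
  have hfin : {p : (f : E.Func) × ExtArgs L E C f |
      (⟨_, extApp p.1 p.2⟩ : Sigma (Term (L.extend E) C)) ∈ extTerms N}.Finite :=
    (extTerms_finite hN).preimage (f := fun p : (f : E.Func) × ExtArgs L E C f =>
      (⟨_, extApp p.1 p.2⟩ : Sigma (Term (L.extend E) C))) fun p _ q _ h => extApp_inj h
  -- A congruence clause needs two argument tuples of the same symbol. Requiring `⟨p.1, us⟩ = q`
  -- leaves at most one clause for each pair `p`, `q`, and none when the symbols differ.
  refine (hfin.biUnion fun p _ => hfin.biUnion (t := fun q =>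
    {D | ∃ us : ExtArgs L E C p.1, (⟨p.1, us⟩ : (f : E.Func) × ExtArgs L E C f) = q ∧
      D = congruenceClause p.1 p.2 us}) fun q _ => ?_).subset ?_
  · refine Set.Subsingleton.finite ?_
    rintro _ ⟨us, rfl, rfl⟩ _ ⟨us', h, rfl⟩
    rw [eq_of_heq (Sigma.mk.inj h).2]
  · rintro D ⟨f, ts, us, h, h', rfl⟩
    exact Set.mem_biUnion (x := ⟨f, ts⟩) h
      (Set.mem_biUnion (x := (⟨f, us⟩ : (f : E.Func) × ExtArgs L E C f)) h' ⟨us, rfl, rfl⟩)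

/-- A variable-free term has the same image under every substitution, so the arbitrary `σ` in `est`
may be replaced by one fixed substitution, which exists because there is a constant of each sort. -/
theorem est_finite [∀ s, Nonempty (C s)] {K : Set (Clause (L.extend E) (Var (S := S)))}
    (hK : K.Finite) {G : Set (Clause (L.extend E) C)} (hG : G.Finite) : (est K G).Finite := by
  refine (extTerms_finite hG).union ((hK.biUnion fun D _ => (Clause.subterms_finite D).image
    fun t => (⟨t.1, t.2.subst fun s _ => .var (Classical.arbitrary (C s))⟩ :
      Sigma (Term (L.extend E) C))).subset ?_)
  rintro _ ⟨D, hD, t, ht, -, hv, σ, rfl⟩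
  refine Set.mem_biUnion hD ⟨t, ht, ?_⟩
  simp only [Sigma.mk.injEq, heq_eq_eq, true_and]
  exact Term.subst_congr fun x hx => by simp [hv] at hx

/-- Every variable of an instance of `D` is mapped into one of the extension terms of the
instance. -/
theorem Clause.VarsBelowExt.exists_extTerm {D : Clause (L.extend E) (Var (S := S))}
    (h : Clause.VarsBelowExt D) (σ : (s : S) → Var s → Term (L.extend E) C s)
    {x : Sigma (Var (S := S))} (hx : x ∈ Clause.vars D) :
    ∃ (f : E.Func) (ts : ExtArgs L E (Var (S := S)) f),
      (⟨_, extApp f ts⟩ : Sigma (Term (L.extend E) (Var (S := S)))) ∈ Clause.subterms D ∧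
      (σ x.1 x.2).subterms ⊆ ((extApp f ts).subst σ).subterms := by
  obtain ⟨t, ht, ⟨f, ts, rfl⟩, hxt⟩ := h x hx
  exact ⟨f, ts, ht, fun u hu => Term.subterms_trans (Term.subst_mem_subterms hxt) hu⟩

theorem instances_finite {K : Set (Clause (L.extend E) (Var (S := S)))} (hK : K.Finite)
    (hKvars : ∀ D ∈ K, Clause.VarsBelowExt D) {T : Set (Sigma (Term (L.extend E) C))}
    (hT : T.Finite) : (instances K T).Finite := by
  have key : ∀ D ∈ K, {D' | ∃ σ : (s : S) → Var s → Term (L.extend E) C s,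
      D' = Clause.subst σ D ∧ ∀ t ∈ Clause.subterms D', IsExtTerm t → t ∈ T}.Finite := by
    intro D hD
    have := (Clause.vars_finite D).to_subtype
    -- `r` restricts a substitution to the variables of `D`, with sorts bundled to give a uniform
    -- codomain. The instance `F σ` depends only on `r σ`, and `r σ` takes values in the finite set
    -- of subterms of terms in `T`. The default `[]` is harmless, since only values at points `r σ`
    -- matter.
    let r : ((s : S) → Var s → Term (L.extend E) C s) →
        (Clause.vars D → Sigma (Term (L.extend E) C)) := fun σ x => ⟨x.1.1, σ x.1.1 x.1.2⟩
    let F : ((s : S) → Var s → Term (L.extend E) C s) → Clause (L.extend E) C :=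
      fun σ => Clause.subst σ D
    have hF : F.FactorsThrough r := by
      intro σ τ h
      refine Clause.subst_congr fun x hx => ?_
      exact eq_of_heq (Sigma.mk.inj (congrFun h ⟨x, hx⟩)).2
    have hB : (⋃ t ∈ T, t.2.subterms).Finite := hT.biUnion fun t _ => t.2.subterms_finite
    refine ((Set.Finite.pi' fun _ : Clause.vars D => hB).image
      (Function.extend r F fun _ => [])).subset ?_
    rintro _ ⟨σ, rfl, h⟩
    refine ⟨r σ, fun x => ?_, hF.extend_apply _ σ⟩
    obtain ⟨f, ts, h1, h2⟩ := (hKvars D hD).exists_extTerm σ x.2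
    exact Set.mem_biUnion (h _ (Clause.subst_mem_subterms h1) ⟨f, _, rfl⟩)
      (h2 (Term.mem_subterms_self _))
  refine (hK.biUnion key).subset ?_
  rintro D' ⟨D, hD, σ, h⟩
  exact Set.mem_biUnion hD ⟨σ, h⟩

theorem exists_algorithmOutput {T₀ : Set (Sentence L)} (hQE : AllowsQE T₀)
    {K : Set (Clause (L.extend E) (Var (S := S)))} (hK : K.Finite)
    (hKvars : ∀ D ∈ K, Clause.VarsBelowExt D) {G : Set (Clause (L.extend E) C)} (hG : G.Finite)
    {T : Set (Sigma (Term (L.extend E) C))} (hT : T.Finite) (Fs : Set E.Func)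
    (Cs : Set (Sigma C)) : ∃ Γ, IsAlgorithmOutput T₀ K G T Fs Cs Γ := by
  have hN := (instances_finite hK hKvars hT).union hG
  obtain ⟨ψ, h, h'⟩ := hQE.exists_eliminant ((hN.image Clause.purify).union (Con₀_finite hN))
    (keptConsts Fs Cs (instances K T ∪ G))
  exact ⟨_, ψ, h, h', rfl⟩

/-! ### Purification -/

theorem Term.eval_purify {M : Structure (L.extend E)} {a : Assignment M C}
    {b : Assignment M.reduct (PConst L E C)} {s : S} {t : Term (L.extend E) C s}
    (hv : ∀ x ∈ t.vars, b x.1 (.inl x.2) = a x.1 x.2)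
    (he : ∀ (f : E.Func) (ts : ExtArgs L E C f),
      (⟨_, extApp f ts⟩ : Sigma (Term (L.extend E) C)) ∈ t.subterms →
        b _ (.inr (extApp f ts)) = (extApp f ts).eval M a) :
    t.purify.eval M.reduct b = t.eval M a := by
  induction t with
  | var x => exact hv ⟨_, x⟩ (by simp [Term.vars_var])
  | func f ts ih =>
    rcases f with f | f
    · exact congrArg (M.fn (Sum.inl f)) (funext fun i => ih i
        (fun x hx => hv x (by rw [Term.vars_func]; exact Set.mem_iUnion.2 ⟨i, hx⟩))
        (fun g us h => he g us (Term.mem_subterms_func.2 (Or.inr ⟨i, h⟩))))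
    · exact he f ts (Term.mem_subterms_self _)

theorem Clause.holds_purify {M : Structure (L.extend E)} {a : Assignment M C}
    {b : Assignment M.reduct (PConst L E C)} {D : Clause (L.extend E) C}
    (hv : ∀ x ∈ Clause.vars D, b x.1 (.inl x.2) = a x.1 x.2)
    (he : ∀ (f : E.Func) (ts : ExtArgs L E C f),
      (⟨_, extApp f ts⟩ : Sigma (Term (L.extend E) C)) ∈ Clause.subterms D →
        b _ (.inr (extApp f ts)) = (extApp f ts).eval M a) :
    Clause.Holds M.reduct b (Clause.purify D) ↔ Clause.Holds M a D := by
  have key : ∀ l ∈ D, ((Literal.purify l).toQF.Holds M.reduct b ↔ l.toQF.Holds M a) := by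
    intro l hl
    have hterm : ∀ (s : S) (t : Term (L.extend E) C s), t.subterms ⊆ l.subterms →
        t.purify.eval M.reduct b = t.eval M a := fun s t ht => Term.eval_purify
      (fun x hx => hv x ⟨l, hl, ht hx⟩) (fun f ts h => he f ts ⟨l, hl, ht h⟩)
    rcases l with ⟨c, t, t'⟩ | ⟨c, P, ts⟩
    · have h : (t.purify.eval M.reduct b = t'.purify.eval M.reduct b) ↔
          (t.eval M a = t'.eval M a) := by
        rw [hterm _ t Set.subset_union_left, hterm _ t' Set.subset_union_right]
        exact Iff.rfl
      cases c
      · exact not_congr h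
      · exact h
    · have h : M.reduct.rel P (fun i => (ts i).purify.eval M.reduct b) ↔
          M.rel P (fun i => (ts i).eval M a) := iff_of_eq (congrArg (M.rel P)
        (funext fun i => hterm _ (ts i) (Set.subset_iUnion (fun i => (ts i).subterms) i)))
      cases c
      · exact not_congr h
      · exact h
  rw [Clause.holds_iff, Clause.holds_iff, Clause.purify]
  simp only [List.mem_map, exists_exists_and_eq_and]
  exact exists_congr fun l => and_congr_right fun hl => key l hl

/-- The interpretation of the constants of the purified problem in which `c_t` denotes `t`. -/
def defAssignment (M : Structure (L.extend E)) (a : Assignment M C) :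
    Assignment M.reduct (PConst L E C) :=
  fun s => Sum.elim (a s) (fun t : Term (L.extend E) C s => t.eval M a)

theorem Term.eval_unpurify {M : Structure (L.extend E)} {a : Assignment M C} {s : S}
    (t : Term L (PConst L E C) s) :
    t.unpurify.eval M a = t.eval M.reduct (defAssignment M a) := by
  induction t with
  | var x => rcases x with c | t <;> rfl
  | func f ts ih => exact congrArg (M.fn (Sum.inl f)) (funext ih)

theorem QFFormula.holds_unpurify {M : Structure (L.extend E)} {a : Assignment M C}
    (φ : QFFormula L (PConst L E C)) :
    φ.unpurify.Holds M a ↔ φ.Holds M.reduct (defAssignment M a) := by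
  induction φ with
  | falsum => exact Iff.rfl
  | eq t t' => exact iff_of_eq (congrArg₂ (· = ·) t.eval_unpurify t'.eval_unpurify)
  | rel P ts => exact iff_of_eq (congrArg (M.rel P) (funext fun i => (ts i).eval_unpurify))
  | imp φ ψ ih ih' => exact imp_congr ih ih'

theorem holds_congruenceClause {M : Structure L} {b : Assignment M (PConst L E C)} {f : E.Func}
    {ts us : ExtArgs L E C f} : Clause.Holds M b (congruenceClause f ts us) ↔
      ((∀ i, (ts i).purify.eval M b = (us i).purify.eval M b) →
        b _ (.inr (extApp f ts)) = b _ (.inr (extApp f us))) := by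
  rw [Clause.holds_iff]
  constructor
  · rintro ⟨l, hl, h⟩ hi
    rcases List.mem_append.1 hl with hl | hl
    · obtain ⟨i, rfl⟩ := (List.mem_ofFn' _ _).1 hl
      exact absurd (hi i) h
    · rw [List.mem_singleton] at hl
      subst hl
      exact h
  · intro h
    by_cases hi : ∀ i, (ts i).purify.eval M b = (us i).purify.eval M b
    · exact ⟨_, List.mem_append.2 (Or.inr (List.mem_singleton.2 rfl)), h hi⟩
    · push Not at hi
      obtain ⟨i, hi⟩ := hi
      exact ⟨_, List.mem_append.2 (Or.inl ((List.mem_ofFn' _ _).2 ⟨i, rfl⟩)), hi⟩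

/-- `defAssignment` witnesses the existential quantifiers: purified clauses regain their original
meaning, and congruence clauses hold because extension symbols denote functions. The larger set `K'`
is needed because the interpolant is computed from `Ks ∪ K₁` only. -/
theorem IsAlgorithmOutput.entails {T₀ : Set (Sentence L)}
    {K K' : Set (Clause (L.extend E) (Var (S := S)))} {G : Set (Clause (L.extend E) C)}
    {T : Set (Sigma (Term (L.extend E) C))} {Fs : Set E.Func} {Cs : Set (Sigma C)}
    {Γ : QFFormula (L.extend E) C} (h : IsAlgorithmOutput T₀ K G T Fs Cs Γ) (hK : K ⊆ K') :
    Entails T₀ K' (Clause.toQF '' G) Γ := by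
  obtain ⟨ψ, -, h, rfl⟩ := h
  intro M a hM hG
  rw [QFFormula.holds_unpurify, h _ _ hM.1]
  refine ⟨defAssignment M a, fun _ _ => rfl, ?_⟩
  have hpur : ∀ t : Sigma (Term (L.extend E) C),
      t.2.purify.eval M.reduct (defAssignment M a) = t.2.eval M a := fun t =>
    Term.eval_purify (fun _ _ => rfl) (fun _ _ _ => rfl)
  rintro _ (⟨D, hD | hD, rfl⟩ | ⟨f, ts, us, -, -, rfl⟩)
  · rw [Clause.holds_purify (a := a) (fun _ _ => rfl) (fun _ _ _ => rfl)]
    obtain ⟨D, hD, σ, rfl, -⟩ := hD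
    rw [Clause.holds_subst]
    exact hM.2 D (hK hD) _
  · rw [Clause.holds_purify (a := a) (fun _ _ => rfl) (fun _ _ _ => rfl)]
    exact hG _ ⟨D, hD, rfl⟩
  · rw [holds_congruenceClause]
    intro hi
    exact congrArg (M.fn (Sum.inr f)) (funext fun i =>
      (hpur ⟨_, ts i⟩).symm.trans ((hi i).trans (hpur ⟨_, us i⟩)))

end Extensions

section Interpolation

variable {L : Signature S} {E : ExtSymbols S} {X : S → Type v}

/-! ### Extension terms with constant arguments -/

/-- The term is a generator or a nullary function symbol of the base signature. -/
def IsBaseConst (t : Sigma (Term (L.extend E) X)) : Prop :=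
  IsVarTerm t ∨ ∃ (f : L.Func) (ts : _), L.dom f = [] ∧
    t = ⟨L.cod f, .func (L := L.extend E) (Sum.inl f) ts⟩

/-- The term is an extension symbol applied to generators and nullary base symbols. -/
def IsShallow (t : Sigma (Term (L.extend E) X)) : Prop :=
  ∃ (f : E.Func) (ts : ExtArgs L E X f), t = ⟨_, extApp f ts⟩ ∧ ∀ i, IsBaseConst ⟨_, ts i⟩

theorem IsBaseConst.eq_of_mem {t u : Sigma (Term (L.extend E) X)} (h : IsBaseConst t)
    (hu : u ∈ t.2.subterms) : u = t := by
  rcases h with ⟨s, x, rfl⟩ | ⟨f, ts, hf, rfl⟩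
  · exact Term.mem_subterms_var.1 hu
  · rcases Term.mem_subterms_func.1 hu with h | ⟨i, -⟩
    · exact h
    · have : (L.dom f).length = 0 := by simp [hf]
      exact absurd (Nat.lt_of_lt_of_eq i.2 this) (Nat.not_lt_zero _)

theorem IsBaseConst.not_isExtTerm {t : Sigma (Term (L.extend E) X)} (h : IsBaseConst t) :
    ¬ IsExtTerm t := by
  rintro ⟨g, us, rfl⟩
  rcases h with ⟨s, x, h⟩ | ⟨f, ts, -, h⟩
  · exact Term.var_ne_func (L := L.extend E) (f := Sum.inr g) h.symm
  · have := congrArg Sigma.fst (Term.func_inj (L := L.extend E) (f := Sum.inr g)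
      (g := Sum.inl f) h)
    exact absurd this Sum.inr_ne_inl

theorem IsShallow.args {f : E.Func} {ts : ExtArgs L E X f}
    (h : IsShallow (⟨_, extApp f ts⟩ : Sigma (Term (L.extend E) X))) :
    ∀ i, IsBaseConst ⟨_, ts i⟩ := by
  obtain ⟨g, us, h, hi⟩ := h
  cases extApp_inj h
  exact hi

theorem IsShallow.eq_of_mem {t u : Sigma (Term (L.extend E) X)} (h : IsShallow t)
    (hu : u ∈ t.2.subterms) (hext : IsExtTerm u) : u = t := by
  obtain ⟨f, ts, rfl, hi⟩ := h
  rcases Term.mem_subterms_func.1 hu with h | ⟨i, h⟩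
  · exact h
  · cases (hi i).eq_of_mem h
    exact absurd hext (hi i).not_isExtTerm

theorem IsBaseConst.eq_var {t : Sigma (Term (L.extend E) X)} (h : IsBaseConst t) {x : Sigma X}
    (hx : x ∈ t.2.vars) : t = ⟨x.1, .var x.2⟩ := (h.eq_of_mem hx).symm

/-- Flatness alone would permit a nullary extension symbol as an argument. Such an argument is
itself an extension term and a constant that it shares with the term around it, so linearity
identifies the two; then the outer symbol is nullary too and has no arguments. -/
theorem isShallow_of_ground {D : Clause (L.extend E) X} (hflat : Clause.GroundFlat D)
    (hlin : Clause.GroundLinear D) {t : Sigma (Term (L.extend E) X)}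
    (ht : t ∈ Clause.subterms D) (hext : IsExtTerm t) : IsShallow t := by
  obtain ⟨f, ts, rfl⟩ := hext
  refine ⟨f, ts, rfl, fun i => ?_⟩
  have hi : (⟨_, ts i⟩ : Sigma (Term (L.extend E) X)) ∈ (extApp f ts).subterms :=
    Term.mem_subterms_func.2 (Or.inr ⟨i, Term.mem_subterms_self _⟩)
  rcases hflat f ts ht i with h | ⟨g | g, us, hg, h⟩
  · exact Or.inl h
  · exact Or.inr ⟨g, us, hg, h⟩
  · exfalso
    have hself : (⟨_, ts i⟩ : Sigma (Term (L.extend E) X)) = ⟨_, extApp f ts⟩ :=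
      hlin.1 ⟨_, ts i⟩ (Or.inr ⟨Sum.inr g, us, hg, h⟩) ⟨_, ts i⟩ (Clause.subterms_trans ht hi) _ ht
        ⟨g, us, h⟩ ⟨f, ts, rfl⟩ (Term.mem_subterms_self _) hi
    have hfg := extApp_inj (h.symm.trans hself)
    cases hfg
    have hf : (E.dom f).length = 0 := by
      have : E.dom f = [] := hg
      simp [this]
    exact absurd (Nat.lt_of_lt_of_eq i.2 hf) (Nat.not_lt_zero _)

theorem IsBaseConst.mem_vars_purify {C : S → Type u} {s : S} {t : Term (L.extend E) C s}
    (h : IsBaseConst ⟨s, t⟩) {p : Sigma (PConst L E C)} :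
    p ∈ t.purify.vars ↔ ∃ x ∈ t.vars, p = ⟨x.1, .inl x.2⟩ := by
  rcases h with ⟨r, x, h⟩ | ⟨f, ts, hf, h⟩
  · cases h
    rw [Term.vars_var]
    have : (Term.var x : Term (L.extend E) C s).purify.vars = {⟨s, .inl x⟩} := Term.vars_var _
    rw [this]
    simp
  · cases h
    have : IsEmpty (Fin (L.dom f).length) := by rw [hf]; exact Fin.isEmpty
    have h1 : (Term.func (L := L.extend E) (Sum.inl f) ts).purify.vars =
      ⋃ i : Fin (L.dom f).length, (ts i).purify.vars := Term.vars_func _ _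
    have h2 : (Term.func (L := L.extend E) (Sum.inl f) ts).vars =
      ⋃ i : Fin (L.dom f).length, (ts i).vars := Term.vars_func _ _
    constructor
    · intro hp
      obtain ⟨i, -⟩ := Set.mem_iUnion.1 ((Set.ext_iff.1 h1 p).1 hp)
      exact isEmptyElim i
    · rintro ⟨x, hx, -⟩
      obtain ⟨i, -⟩ := Set.mem_iUnion.1 ((Set.ext_iff.1 h2 x).1 hx)
      exact isEmptyElim i

variable {C : S → Type u}

theorem mem_extTerms_or_vars_eq_empty {K : Set (Clause (L.extend E) (Var (S := S)))}
    {G : Set (Clause (L.extend E) C)} {t : Sigma (Term (L.extend E) C)} (h : t ∈ est K G) :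
    t ∈ extTerms G ∨ t.2.vars = ∅ := by
  refine h.imp_right ?_
  rintro ⟨D, hD, t', ht', -, hv, σ, rfl⟩
  refine Set.eq_empty_iff_forall_notMem.2 fun x hx => ?_
  obtain ⟨y, hy, -⟩ := Term.mem_vars_subst hx
  rw [hv] at hy
  exact hy

/-- For a variable-free term from `K`: in a clause with variables, flatness allows only variables as
arguments, so there are none; in a variable-free clause the ground case applies. Substitution then
keeps nullary base symbols nullary. -/
theorem isShallow_of_mem_est {K : Set (Clause (L.extend E) (Var (S := S)))}
    (hKflat : ∀ D ∈ K, Clause.Flat D) (hKlin : ∀ D ∈ K, Clause.Linear D)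
    {G : Set (Clause (L.extend E) C)} (hGflat : ∀ D ∈ G, Clause.GroundFlat D)
    (hGlin : ∀ D ∈ G, Clause.GroundLinear D) {t : Sigma (Term (L.extend E) C)}
    (h : t ∈ est K G) : IsShallow t := by
  rcases h with ⟨hext, D, hD, ht⟩ | ⟨D, hD, t', ht', hext, hv, σ, rfl⟩
  · exact isShallow_of_ground (hGflat D hD) (hGlin D hD) ht hext
  · obtain ⟨f, ts, rfl⟩ := hext
    refine ⟨f, fun i => (ts i).subst σ, rfl, fun i => ?_⟩
    have hvi : ∀ x, x ∉ (ts i).vars := by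
      intro x hx
      have : x ∈ (extApp f ts).vars :=
        Term.mem_subterms_func.2 (Or.inr ⟨i, hx⟩)
      rw [hv] at this
      exact this
    have hi : IsBaseConst ⟨_, ts i⟩ := by
      by_cases hD0 : Clause.vars D = ∅
      · exact (isShallow_of_ground ((hKflat D hD).1 hD0) ((hKlin D hD).1 hD0) ht'
          ⟨f, ts, rfl⟩).args i
      · exact Or.inl ((hKflat D hD).2 hD0 f ts ht' i)
    change IsBaseConst ⟨_, (ts i).subst σ⟩
    generalize ts i = u at hi hvi ⊢
    rcases hi with ⟨s, x, h⟩ | ⟨g, us, hg, h⟩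
    · obtain ⟨rfl, h⟩ := Sigma.mk.inj h
      cases h
      exact absurd (Term.mem_subterms_self _) (hvi ⟨_, x⟩)
    · refine Or.inr ⟨g, fun j => (us j).subst σ, hg, ?_⟩
      exact congrArg (fun t : Sigma (Term (L.extend E) (Var (S := S))) =>
        (⟨t.1, t.2.subst σ⟩ : Sigma (Term (L.extend E) C))) h

/-- If the extension terms of `D` become shallow in the instance `Dσ`, then all extension terms of
`Dσ` are instances of extension terms of `D`. -/
theorem Clause.VarsBelowExt.extTerm_subst {D : Clause (L.extend E) (Var (S := S))}
    (hD : Clause.VarsBelowExt D) {σ : (s : S) → Var s → Term (L.extend E) C s}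
    (hsh : ∀ (f : E.Func) (ts : ExtArgs L E (Var (S := S)) f),
      (⟨_, extApp f ts⟩ : Sigma (Term (L.extend E) (Var (S := S)))) ∈ Clause.subterms D →
        IsShallow (⟨_, (extApp f ts).subst σ⟩ : Sigma (Term (L.extend E) C)))
    {u : Sigma (Term (L.extend E) C)} (hu : u ∈ Clause.subterms (Clause.subst σ D))
    (hext : IsExtTerm u) : ∃ (f : E.Func) (ts : ExtArgs L E (Var (S := S)) f),
      (⟨_, extApp f ts⟩ : Sigma (Term (L.extend E) (Var (S := S)))) ∈ Clause.subterms D ∧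
        u = ⟨_, (extApp f ts).subst σ⟩ := by
  rcases Clause.mem_subterms_subst hu with ⟨f | f, ts, hf, h⟩ | ⟨x, hx, h⟩
  · obtain ⟨g, us, rfl⟩ := hext
    have := congrArg Sigma.fst (Term.func_inj (L := L.extend E) (f := Sum.inr g)
      (g := Sum.inl f) h)
    exact absurd this Sum.inr_ne_inl
  · exact ⟨f, ts, hf, h⟩
  · obtain ⟨f, ts, h1, h2⟩ := hD.exists_extTerm σ hx
    exact ⟨f, ts, h1, (hsh f ts h1).eq_of_mem (h2 h) hext⟩

theorem extTerms_instances_subset {K K' : Set (Clause (L.extend E) (Var (S := S)))}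
    {G : Set (Clause (L.extend E) C)} : extTerms (instances K' (est K G) ∪ G) ⊆ est K G := by
  rintro t ⟨hext, D, ⟨D₀, -, σ, -, h⟩ | hD, ht⟩
  · exact h t ht hext
  · exact Or.inl ⟨hext, D, hD, ht⟩

/-- Since the extension terms of an instance are shallow, substituting for variables creates none
with a new root symbol: each is an instance of an extension term of the clause itself. -/
theorem extFuncs_instances {K K' : Set (Clause (L.extend E) (Var (S := S)))}
    (hKvars : ∀ D ∈ K', Clause.VarsBelowExt D) {G : Set (Clause (L.extend E) C)}
    (hsh : ∀ t ∈ est K G, IsShallow t) {F : Set E.Func}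
    (hK : ∀ D ∈ K', Clause.extFuncs D ⊆ F) (hG : ∀ D ∈ G, Clause.extFuncs D ⊆ F)
    {f : E.Func} {ts : ExtArgs L E C f}
    (h : (⟨_, extApp f ts⟩ : Sigma (Term (L.extend E) C)) ∈
      extTerms (instances K' (est K G) ∪ G)) : f ∈ F := by
  obtain ⟨hext, D, ⟨D₀, hD₀, σ, rfl, hσ⟩ | hD, ht⟩ := h
  · obtain ⟨g, us, h1, h2⟩ := (hKvars D₀ hD₀).extTerm_subst (fun g us h =>
      hsh _ (hσ _ (Clause.subst_mem_subterms h) ⟨g, _, rfl⟩)) ht hext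
    cases congrArg Sigma.fst (extApp_inj (us := fun i => (us i).subst σ) h2)
    exact hK D₀ hD₀ ⟨_, h1, f, us, rfl, rfl⟩
  · exact hG D hD ⟨_, ht, f, ts, rfl, rfl⟩

/-- A constant enters an instance through a variable, hence below an extension term of the instance.
That term lies in `est K G`, so it occurs in `G` or contains no constants of `C` at all. -/
theorem vars_instances {K K' : Set (Clause (L.extend E) (Var (S := S)))}
    (hKvars : ∀ D ∈ K', Clause.VarsBelowExt D) {G : Set (Clause (L.extend E) C)}
    {D : Clause (L.extend E) C} (hD : D ∈ instances K' (est K G) ∪ G) {c : Sigma C}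
    (hc : c ∈ Clause.vars D) : ∃ D ∈ G, c ∈ Clause.vars D := by
  rcases hD with ⟨D₀, hD₀, σ, rfl, hσ⟩ | hD
  · rcases Clause.mem_subterms_subst hc with ⟨f, ts, -, h⟩ | ⟨x, hx, h⟩
    · exact absurd h Term.var_ne_func
    · obtain ⟨f, ts, h1, h2⟩ := (hKvars D₀ hD₀).exists_extTerm σ hx
      have hmem : c ∈ ((extApp f ts).subst σ).vars := h2 h
      rcases mem_extTerms_or_vars_eq_empty
        (hσ _ (Clause.subst_mem_subterms h1) ⟨f, _, rfl⟩) with ⟨-, D, hD, h'⟩ | h'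
      · exact ⟨D, hD, Clause.subterms_trans h' hmem⟩
      · rw [h'] at hmem
        exact hmem.elim
  · exact ⟨D, hD, hc⟩

/-! ### The symbols of the output -/

theorem Term.mem_vars_unpurify {s : S} {t : Term L (PConst L E C) s} {x : Sigma C}
    (hx : x ∈ t.unpurify.vars) : (⟨x.1, .inl x.2⟩ : Sigma (PConst L E C)) ∈ t.vars ∨
      ∃ u : Sigma (Term (L.extend E) C), ⟨u.1, .inr u.2⟩ ∈ t.vars ∧ x ∈ u.2.vars := by
  induction t with
  | var p =>
    rw [Term.vars_var]
    rcases p with c | u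
    · have : x = ⟨_, c⟩ := Term.var_inj (Term.mem_subterms_var.1 hx)
      subst this
      exact Or.inl rfl
    · exact Or.inr ⟨⟨_, u⟩, rfl, hx⟩
  | func f ts ih =>
    rcases Term.mem_subterms_func.1 hx with h | ⟨i, hi⟩
    · exact absurd h Term.var_ne_func
    · rw [Term.vars_func]
      exact (ih i hi).imp (fun h => Set.mem_iUnion.2 ⟨i, h⟩)
        (fun ⟨u, h, h'⟩ => ⟨u, Set.mem_iUnion.2 ⟨i, h⟩, h'⟩)

theorem Term.mem_funcs_unpurify {s : S} {t : Term L (PConst L E C) s} {f : E.Func}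
    (hf : (Sum.inr f : L.Func ⊕ E.Func) ∈ t.unpurify.funcs) :
    ∃ u : Sigma (Term (L.extend E) C), (⟨u.1, .inr u.2⟩ : Sigma (PConst L E C)) ∈ t.vars ∧
      (Sum.inr f : L.Func ⊕ E.Func) ∈ u.2.funcs := by
  induction t with
  | var p =>
    rcases p with c | u
    · obtain ⟨ts, h⟩ := hf
      exact absurd (Term.mem_subterms_var.1 h).symm Term.var_ne_func
    · exact ⟨⟨_, u⟩, Term.mem_subterms_self _, hf⟩
  | func g ts ih =>
    rcases Term.mem_funcs_func.1 hf with h | ⟨i, hi⟩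
    · exact absurd h Sum.inr_ne_inl
    · obtain ⟨u, h, h'⟩ := ih i hi
      exact ⟨u, by rw [Term.vars_func]; exact Set.mem_iUnion.2 ⟨i, h⟩, h'⟩

theorem QFFormula.mem_vars_unpurify {φ : QFFormula L (PConst L E C)} {x : Sigma C}
    (hx : x ∈ φ.unpurify.vars) : (⟨x.1, .inl x.2⟩ : Sigma (PConst L E C)) ∈ φ.vars ∨
      ∃ u : Sigma (Term (L.extend E) C), ⟨u.1, .inr u.2⟩ ∈ φ.vars ∧ x ∈ u.2.vars := by
  induction φ with
  | falsum => exact hx.elim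
  | eq t t' =>
    rcases hx with hx | hx
    · exact (Term.mem_vars_unpurify hx).imp Or.inl fun ⟨u, h, h'⟩ => ⟨u, Or.inl h, h'⟩
    · exact (Term.mem_vars_unpurify hx).imp Or.inr fun ⟨u, h, h'⟩ => ⟨u, Or.inr h, h'⟩
  | rel P ts =>
    obtain ⟨i, hi⟩ := Set.mem_iUnion.1 hx
    exact (Term.mem_vars_unpurify hi).imp (fun h => Set.mem_iUnion.2 ⟨i, h⟩)
      (fun ⟨u, h, h'⟩ => ⟨u, Set.mem_iUnion.2 ⟨i, h⟩, h'⟩)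
  | imp φ ψ ih ih' =>
    rcases hx with hx | hx
    · exact (ih hx).imp Or.inl fun ⟨u, h, h'⟩ => ⟨u, Or.inl h, h'⟩
    · exact (ih' hx).imp Or.inr fun ⟨u, h, h'⟩ => ⟨u, Or.inr h, h'⟩

theorem QFFormula.mem_extFuncs_unpurify {φ : QFFormula L (PConst L E C)} {f : E.Func}
    (hf : f ∈ φ.unpurify.extFuncs) :
    ∃ u : Sigma (Term (L.extend E) C), (⟨u.1, .inr u.2⟩ : Sigma (PConst L E C)) ∈ φ.vars ∧
      (Sum.inr f : L.Func ⊕ E.Func) ∈ u.2.funcs := by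
  induction φ with
  | falsum => exact hf.elim
  | eq t t' =>
    rcases hf with hf | hf
    · exact (Term.mem_funcs_unpurify hf).imp fun u h => ⟨Or.inl h.1, h.2⟩
    · exact (Term.mem_funcs_unpurify hf).imp fun u h => ⟨Or.inr h.1, h.2⟩
  | rel P ts =>
    obtain ⟨i, hi⟩ := Set.mem_iUnion.1 hf
    exact (Term.mem_funcs_unpurify hi).imp fun u h => ⟨Set.mem_iUnion.2 ⟨i, h.1⟩, h.2⟩
  | imp φ ψ ih ih' =>
    rcases hf with hf | hf
    · exact (ih hf).imp fun u h => ⟨Or.inl h.1, h.2⟩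
    · exact (ih' hf).imp fun u h => ⟨Or.inr h.1, h.2⟩

/-- This is why the arguments of shared symbols in `G` suffice, although those in all of `N` are
kept: terms contributed by `K` alone contain no constants of `C`. -/
theorem inl_mem_keptConsts {K K' : Set (Clause (L.extend E) (Var (S := S)))}
    {G : Set (Clause (L.extend E) C)} (hsh : ∀ t ∈ est K G, IsShallow t) {Fs : Set E.Func}
    {Cs : Set (Sigma C)} {c : Sigma C} :
    (⟨c.1, .inl c.2⟩ : Sigma (PConst L E C)) ∈ keptConsts Fs Cs (instances K' (est K G) ∪ G) ↔
      c ∈ Cs ∪ argConsts Fs G := by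
  constructor
  · rintro ((⟨d, hd, h⟩ | ⟨t, -, -, h⟩) | ⟨f, ts, hf, hts, i, hi⟩)
    · obtain ⟨s, c⟩ := c
      obtain ⟨r, d⟩ := d
      cases h
      exact Or.inl hd
    · obtain ⟨s, c⟩ := c
      obtain ⟨r, t⟩ := t
      cases h
    · have hest := extTerms_instances_subset hts
      have hbase := (hsh _ hest).args i
      obtain ⟨d, hd, h⟩ := hbase.mem_vars_purify.1 hi
      obtain ⟨s, c⟩ := c
      obtain ⟨r, d⟩ := d
      cases h
      rcases mem_extTerms_or_vars_eq_empty hest with h | h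
      · exact Or.inr ⟨f, ts, hf, h, i, hbase.eq_var hd⟩
      · have : (⟨s, c⟩ : Sigma C) ∈ (extApp f ts).vars :=
          Term.mem_subterms_func.2 (Or.inr ⟨i, hd⟩)
        rw [h] at this
        exact this.elim
  · rintro (h | ⟨f, ts, hf, ⟨hext, D, hD, hts⟩, i, hi⟩)
    · exact Or.inl (Or.inl ⟨c, h, rfl⟩)
    · refine Or.inr ⟨f, ts, hf, ⟨hext, D, Or.inr hD, hts⟩, i, ?_⟩
      have hbase := (hsh _ (Or.inl ⟨hext, D, hD, hts⟩)).args i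
      have hc : c ∈ (ts i).vars := by
        have h := Term.mem_subterms_self (ts i)
        rw [hi] at h
        exact h
      exact hbase.mem_vars_purify.2 ⟨c, hc, rfl⟩

theorem inr_mem_keptConsts {K K' : Set (Clause (L.extend E) (Var (S := S)))}
    {G : Set (Clause (L.extend E) C)} (hsh : ∀ t ∈ est K G, IsShallow t) {Fs : Set E.Func}
    {Cs : Set (Sigma C)} {t : Sigma (Term (L.extend E) C)}
    (h : (⟨t.1, .inr t.2⟩ : Sigma (PConst L E C)) ∈
      keptConsts Fs Cs (instances K' (est K G) ∪ G)) :
    t ∈ est K G ∧ HasRootIn Fs t := by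
  obtain ⟨s, t⟩ := t
  rcases h with (⟨⟨r, d⟩, hd, h⟩ | ⟨⟨r, u⟩, hu, hroot, h⟩) | ⟨f, ts, hf, hts, i, hi⟩
  · cases h
  · cases h
    exact ⟨extTerms_instances_subset hu, hroot⟩
  · obtain ⟨⟨r, d⟩, hd, h⟩ :=
      ((hsh _ (extTerms_instances_subset hts)).args i).mem_vars_purify.1 hi
    cases h

/-- Replacing back inserts only shallow terms with root in `Fs`. Shallowness excludes further
extension symbols below the root, and the constants below it are arguments of shared symbols in `G`.
-/
theorem IsAlgorithmOutput.symbols {T₀ : Set (Sentence L)}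
    {K K' : Set (Clause (L.extend E) (Var (S := S)))} {G : Set (Clause (L.extend E) C)}
    (hsh : ∀ t ∈ est K G, IsShallow t) {Fs : Set E.Func} {Cs : Set (Sigma C)}
    {Γ : QFFormula (L.extend E) C} (h : IsAlgorithmOutput T₀ K' G (est K G) Fs Cs Γ) :
    Γ.extFuncs ⊆ Fs ∧ Γ.vars ⊆ Cs ∪ argConsts Fs G := by
  obtain ⟨ψ, hψ, -, rfl⟩ := h
  constructor
  · intro f hf
    obtain ⟨u, hu, hfu⟩ := QFFormula.mem_extFuncs_unpurify hf
    obtain ⟨hest, g, ts, hg, rfl⟩ := inr_mem_keptConsts hsh (hψ hu)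
    rcases Term.mem_funcs_func.1 hfu with h | ⟨i, us, h⟩
    · cases h
      exact hg
    · have hbase := (hsh _ hest).args i
      exact absurd ⟨f, us, (hbase.eq_of_mem h).symm⟩ hbase.not_isExtTerm
  · intro c hc
    rcases QFFormula.mem_vars_unpurify hc with h | ⟨u, hu, hcu⟩
    · exact (inl_mem_keptConsts hsh).1 (hψ h)
    · obtain ⟨hest, g, ts, hg, rfl⟩ := inr_mem_keptConsts hsh (hψ hu)
      rcases mem_extTerms_or_vars_eq_empty hest with h | h
      · rcases Term.mem_subterms_func.1 hcu with h' | ⟨i, hi⟩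
        · exact absurd h' Term.var_ne_func
        · exact Or.inr ⟨g, ts, hg, h, i, ((hsh _ hest).args i).eq_var hi⟩
      · rw [h] at hcu
        exact hcu.elim

/-! ### Uniform interpolation -/

theorem Clause.mem_extFuncs_toQF {D : Clause (L.extend E) X} {f : E.Func} :
    f ∈ (Clause.toQF D).extFuncs ↔ f ∈ Clause.extFuncs D := by
  have h : f ∈ (Clause.toQF D).extFuncs ↔
      ∃ ts, (⟨_, extApp f ts⟩ : Sigma (Term (L.extend E) X)) ∈ Clause.subterms D :=
    Clause.mem_funcs_toQF (L := L.extend E)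
  rw [h]
  constructor
  · rintro ⟨ts, h⟩
    exact ⟨_, h, f, ts, rfl, rfl⟩
  · rintro ⟨_, h, g, ts, rfl, rfl⟩
    exact ⟨ts, h⟩

open Classical in
/-- The functions of `M`, those in `F` being redefined on the terms in `U` so that the term `t`
denotes the value of `c_t`. -/
noncomputable def redefine (M : Structure (L.extend E)) (b : Assignment M.reduct (PConst L E C))
    (F : Set E.Func) (U : Set (Sigma (Term (L.extend E) C))) : (f : (L.extend E).Func) →
    ((i : Fin ((L.extend E).dom f).length) → M.carrier (((L.extend E).dom f).get i)) →
      M.carrier ((L.extend E).cod f)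
  | .inl f => M.fn (.inl f)
  | .inr f => fun v =>
    if h : f ∈ F ∧ ∃ ts : ExtArgs L E C f, ⟨_, extApp f ts⟩ ∈ U ∧
      ∀ i, (ts i).purify.eval M.reduct b = v i
    then b _ (.inr (extApp f h.2.choose)) else M.fn (.inr f) v

theorem redefine_of_notMem {M : Structure (L.extend E)}
    {b : Assignment M.reduct (PConst L E C)} {F : Set E.Func}
    {U : Set (Sigma (Term (L.extend E) C))} {f : E.Func} (hf : f ∉ F) :
    redefine M b F U (.inr f) = M.fn (.inr f) :=
  funext fun _ => dif_neg fun h => hf h.1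

/-- Several terms may have the same argument values, and `redefine` chooses one of them. The
congruence clause between the chosen term and `ts` shows that the choice does not matter. -/
theorem redefine_of_mem {M : Structure (L.extend E)}
    {b : Assignment M.reduct (PConst L E C)} {F : Set E.Func}
    {N : Set (Clause (L.extend E) C)} (hb : ∀ D ∈ Con₀ N, Clause.Holds M.reduct b D)
    {f : E.Func} (hf : f ∈ F) {ts : ExtArgs L E C f}
    (hts : (⟨_, extApp f ts⟩ : Sigma (Term (L.extend E) C)) ∈ extTerms N) :
    redefine M b F (extTerms N) (.inr f) (fun i => (ts i).purify.eval M.reduct b) =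
      b _ (.inr (extApp f ts)) := by
  have h : f ∈ F ∧ ∃ us : ExtArgs L E C f, ⟨_, extApp f us⟩ ∈ extTerms N ∧
      ∀ i, (us i).purify.eval M.reduct b = (ts i).purify.eval M.reduct b :=
    ⟨hf, ts, hts, fun _ => rfl⟩
  exact (dif_pos h).trans (holds_congruenceClause.1
    (hb _ ⟨f, h.2.choose, ts, h.2.choose_spec.1, hts, rfl⟩) h.2.choose_spec.2)

theorem holds_redefine {M : Structure (L.extend E)} {b : Assignment M.reduct (PConst L E C)}
    {F : Set E.Func} {U : Set (Sigma (Term (L.extend E) C))} {a a' : Assignment M X}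
    {φ : QFFormula (L.extend E) X} (hφ : ∀ f ∈ φ.extFuncs, f ∉ F)
    (ha : ∀ x ∈ φ.vars, a' x.1 x.2 = a x.1 x.2) :
    φ.Holds (M.withFn (redefine M b F U)) a' ↔ φ.Holds M a := by
  refine QFFormula.holds_congr (fun f hf => ?_) ha
  rcases f with f | f
  · rfl
  · exact redefine_of_notMem (hφ f hf)

theorem IsAlgorithmOutput.isGeneralUniformInterpolant {T₀ : Set (Sentence L)}
    {Fs F₁ Fi : Set E.Func}
    (hs1 : Disjoint Fs F₁) (h1i : Disjoint F₁ Fi)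
    {Ks K₁ Ki : Set (Clause (L.extend E) (Var (S := S)))}
    (hKvars : ∀ D ∈ Ks ∪ K₁ ∪ Ki, Clause.VarsBelowExt D)
    {G : Set (Clause (L.extend E) C)} (hGfin : G.Finite)
    (hsh : ∀ t ∈ est (Ks ∪ K₁ ∪ Ki) G, IsShallow t)
    (hGsig : ∀ D ∈ G, Clause.extFuncs D ⊆ Fs ∪ F₁) {Cs : Set (Sigma C)}
    (hloc : IsLocalExtension C T₀ (Ks ∪ K₁ ∪ Ki))
    (hKs : ∀ D ∈ Ks, Clause.extFuncs D ⊆ Fs) (hK₁ : ∀ D ∈ K₁, Clause.extFuncs D ⊆ F₁)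
    (hKi : ∀ D ∈ Ki, Clause.extFuncs D ⊆ Fi)
    (hF₁ : ∀ f ∈ F₁, ∃ D ∈ G, f ∈ Clause.extFuncs D) {Γ : QFFormula (L.extend E) C}
    (hΓ : IsAlgorithmOutput T₀ (Ks ∪ K₁) G (est (Ks ∪ K₁ ∪ Ki) G) Fs Cs Γ) :
    IsGeneralUniformInterpolant T₀ (Ks ∪ K₁ ∪ Ki) (Clause.toQF '' G) Fs
      (Cs ∪ argConsts Fs G) Γ := by
  classical
  refine ⟨hΓ.symbols hsh, hΓ.entails Set.subset_union_left, fun θ hθf hθc hent M a hM hMΓ => ?_⟩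
  obtain ⟨Γ₁, -, hΓ₁, rfl⟩ := hΓ
  have hMΓ := QFFormula.holds_unpurify Γ₁ |>.1 (hMΓ _ rfl)
  obtain ⟨b, hkept, hb⟩ := (hΓ₁ _ _ hM.1).1 hMΓ
  set N := instances (Ks ∪ K₁) (est (Ks ∪ K₁ ∪ Ki) G) ∪ G with hN
  -- Every symbol of `F₁` occurs in `G`; if it also occurred in `θ` it would be shared, and so would
  -- belong to `Fs`.
  have hθF₁ : ∀ f ∈ θ.extFuncs, f ∉ F₁ := by
    intro f hf hf1
    obtain ⟨D, hD, h⟩ := hF₁ f hf1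
    exact Set.disjoint_left.1 hs1
      (hθf f hf ⟨_, ⟨D, hD, rfl⟩, Clause.mem_extFuncs_toQF.2 h⟩) hf1
  have hvars12 : ∀ D ∈ Ks ∪ K₁, Clause.VarsBelowExt D := fun D hD => hKvars D (Or.inl hD)
  have hkeptC : ∀ c ∈ Cs ∪ argConsts Fs G, b c.1 (.inl c.2) = a c.1 c.2 := fun c hc =>
    hkept ⟨c.1, .inl c.2⟩ ((inl_mem_keptConsts hsh).2 hc)
  -- Constants of `G` follow `b`, so that `N` becomes true; the others follow `a`, so that `θ` is
  -- not affected. On the shared constants the two agree.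
  let a' : Assignment M C := fun s c =>
    if ∃ D ∈ G, (⟨s, c⟩ : Sigma C) ∈ Clause.vars D then b s (.inl c) else a s c
  have ha'G : ∀ c : Sigma C, (∃ D ∈ G, c ∈ Clause.vars D) → b c.1 (.inl c.2) = a' c.1 c.2 :=
    fun c hc => (if_pos hc).symm
  have ha'C : ∀ c ∈ Cs ∪ argConsts Fs G, a' c.1 c.2 = a c.1 c.2 := by
    intro c hc
    by_cases h : ∃ D ∈ G, c ∈ Clause.vars D
    · exact (ha'G c h).symm.trans (hkeptC c hc)
    · exact if_neg h
  let M' : Structure (L.extend E) := M.withFn (redefine M b F₁ (extTerms N))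
  have hvarsN : ∀ D ∈ N, ∀ c ∈ Clause.vars D, b c.1 (.inl c.2) = a' c.1 c.2 :=
    fun D hD c hc => ha'G c (vars_instances hvars12 hD hc)
  -- In the modified structure each occurring `t` has the value of `c_t`, so purified clauses and
  -- their originals have the same truth value. For a root in `Fs`, both `c_t` and its arguments are
  -- kept and the function is unchanged; for a root in `F₁` this is what `redefine` was made for.
  have hterm : ∀ (f : E.Func) (ts : ExtArgs L E C f),
      (⟨_, extApp f ts⟩ : Sigma (Term (L.extend E) C)) ∈ extTerms N →
        b _ (.inr (extApp f ts)) = (extApp f ts).eval M' a' := by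
    intro f ts hts
    have hbase := (hsh _ (extTerms_instances_subset hts)).args
    obtain ⟨-, D, hD, htsD⟩ := id hts
    have hvi : ∀ i, ∀ c ∈ (ts i).vars, b c.1 (.inl c.2) = a' c.1 c.2 := fun i c hc =>
      hvarsN D hD c (Clause.subterms_trans htsD (Term.mem_subterms_func.2 (Or.inr ⟨i, hc⟩)))
    have hargs : ∀ i, (ts i).purify.eval M.reduct b = (ts i).eval M' a' := fun i =>
      Term.eval_purify (M := M') (hvi i) fun g us h =>
        absurd ⟨g, us, ((hbase i).eq_of_mem h).symm⟩ (hbase i).not_isExtTerm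
    rcases extFuncs_instances hvars12 hsh (F := Fs ∪ F₁) (fun D hD => hD.elim
      (fun hD => (hKs D hD).trans Set.subset_union_left)
      (fun hD => (hK₁ D hD).trans Set.subset_union_right)) hGsig hts with hf | hf
    · have hc : b _ (.inr (extApp f ts)) = (extApp f ts).eval M a :=
        hkept ⟨_, .inr (extApp f ts)⟩ (Or.inl (Or.inr ⟨_, hts, ⟨f, ts, hf, rfl⟩, rfl⟩))
      refine hc.trans ((Term.eval_congr (fun g hg => ?_) fun c hc => ?_).symm)
      · rcases g with g | g
        · rfl
        · rcases Term.mem_funcs_func.1 hg with h | ⟨i, us, h⟩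
          · cases h
            exact redefine_of_notMem (Set.disjoint_left.1 hs1 hf)
          · exact absurd ⟨g, us, ((hbase i).eq_of_mem h).symm⟩ (hbase i).not_isExtTerm
      · rcases Term.mem_subterms_func.1 hc with h | ⟨i, hi⟩
        · exact absurd h Term.var_ne_func
        · exact (hvi i c hi).symm.trans (hkept ⟨c.1, .inl c.2⟩ (Or.inr ⟨f, ts, hf, hts, i,
            (hbase i).mem_vars_purify.2 ⟨c, hi, rfl⟩⟩))
    · refine (redefine_of_mem (fun D hD => hb D (Or.inr hD)) hf hts).symm.trans ?_
      exact congrArg (redefine M b F₁ (extTerms N) (.inr f)) (funext hargs)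
  have hNholds : ∀ D ∈ N, Clause.Holds M' a' D := fun D hD =>
    (Clause.holds_purify (M := M') (hvarsN D hD)
      fun f ts h => hterm f ts ⟨⟨f, ts, rfl⟩, D, hD, h⟩).1 (hb _ (Or.inl ⟨D, hD, rfl⟩))
  -- Clauses without `F₁` mean the same in `M` and `M'`, whose carriers coincide, so all their
  -- instances hold, including those at terms that only `θ` contributes.
  have hKother : ∀ D ∈ Ks ∪ K₁ ∪ Ki, (∀ f ∈ Clause.extFuncs D, f ∉ F₁) →
      ∀ σ : (s : S) → Var s → Term (L.extend E) C s,
        Clause.Holds M' a' (Clause.subst σ D) := fun D hD hDf σ =>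
    (Clause.holds_subst D).2 ((holds_redefine
      (fun f hf => hDf f (Clause.mem_extFuncs_toQF.1 hf)) fun _ _ => rfl).2 (hM.2 D hD _))
  by_contra hθ
  have hθ' : ¬ θ.Holds M' a' := by
    refine mt (holds_redefine hθF₁ fun c hc => ?_).1 hθ
    by_cases h : ∃ D ∈ G, c ∈ Clause.vars D
    · obtain ⟨D, hD, h⟩ := h
      exact ha'C c (hθc c hc ⟨_, ⟨D, hD, rfl⟩, Clause.mem_vars_toQF.2 h⟩)
    · exact if_neg h
  -- Locality concerns clauses, so the negation of `θ` is added in clause normal form. As `G`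
  -- entails `θ`, this set has no model over `T₀ ∪ K`; `M'` with `a'` is shown to be a model of the
  -- local instances, which is a contradiction.
  refine (hloc (G ∪ {D | D ∈ θ.cnf false}) (hGfin.union (List.finite_toSet _))).1 ?_
    ⟨M', a', hM.1, ?_, ?_⟩
  · rintro ⟨M₂, a₂, hM₂, h⟩
    refine (QFFormula.holds_cnf θ).2.1 (fun D hD => h D (Or.inr hD)) (hent M₂ a₂ hM₂ ?_)
    rintro _ ⟨D, hD, rfl⟩
    exact h D (Or.inl hD)
  · rintro _ ⟨D, hD, σ, rfl, hσ⟩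
    rcases id hD with (hDs | hD1) | hDi
    · exact hKother D hD (fun f hf => Set.disjoint_left.1 hs1 (hKs D hDs hf)) σ
    · have hest : ∀ (f : E.Func) (ts : ExtArgs L E (Var (S := S)) f),
          (⟨_, extApp f ts⟩ : Sigma (Term (L.extend E) (Var (S := S)))) ∈ Clause.subterms D →
            (⟨_, (extApp f ts).subst σ⟩ : Sigma (Term (L.extend E) C)) ∈
              est (Ks ∪ K₁ ∪ Ki) G := by
        intro f ts h
        -- The term stems from `G`, from the negation of `θ`, or from `K`. The second case is
        -- impossible: its root is in `F₁`, and forming the normal form introduces no function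
        -- symbols.
        rcases hσ _ (Clause.subst_mem_subterms h) ⟨f, _, rfl⟩ with ⟨hext, D', hD' | hD', h'⟩ | h'
        · exact Or.inl ⟨hext, D', hD', h'⟩
        · exact absurd (hK₁ D hD1 ⟨_, h, f, ts, rfl, rfl⟩)
            (hθF₁ f (QFFormula.funcs_cnf hD' h'))
        · exact Or.inr h'
      -- The instance already belongs to `N`. Extension terms inside the values of variables must
      -- also be in `est`; by shallowness they are themselves instances of extension terms of `D`.
      refine hNholds _ (Or.inl ⟨D, Or.inr hD1, σ, rfl, fun u hu hext => ?_⟩)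
      obtain ⟨f, ts, h, rfl⟩ :=
        (hKvars D hD).extTerm_subst (fun f ts h => hsh _ (hest f ts h)) hu hext
      exact hest f ts h
    · exact hKother D hD (fun f hf h => Set.disjoint_left.1 h1i h (hKi D hDi hf)) σ
  · rintro D (hD | hD)
    · exact hNholds D (Or.inr hD)
    · exact (QFFormula.holds_cnf θ).2.2 hθ' D hD

end Interpolation

end MSL

open MSL
theorem mainTheorem2 {S : Type u} (L : Signature S) (E : ExtSymbols S)
    (C : S → Type u) [∀ s, Nonempty (C s)]
    (T₀ : Set (Sentence L)) (hQE : AllowsQE T₀)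
    -- the extension symbols are the disjoint union of `Fs`, `F₁` and `Fi`
    (Fs F₁ Fi : Set E.Func) (hcover : Fs ∪ F₁ ∪ Fi = Set.univ)
    (hs1 : Disjoint Fs F₁) (hsi : Disjoint Fs Fi) (h1i : Disjoint F₁ Fi)
    (K : Set (Clause (L.extend E) (Var (S := S)))) (hKfin : K.Finite)
    (hKflat : ∀ D ∈ K, Clause.Flat D) (hKlin : ∀ D ∈ K, Clause.Linear D)
    (hKvars : ∀ D ∈ K, Clause.VarsBelowExt D)
    (G : Set (Clause (L.extend E) C)) (hGfin : G.Finite)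
    (hGflat : ∀ D ∈ G, Clause.GroundFlat D) (hGlin : ∀ D ∈ G, Clause.GroundLinear D)
    (hGsig : ∀ D ∈ G, Clause.extFuncs D ⊆ Fs ∪ F₁)
    (Cs : Set (Sigma C)) :
    (∀ T : Set (Sigma (Term (L.extend E) C)), T.Finite →
      (∀ t ∈ T, FlatWrt IsConstTerm t.2.subterms) → est K G ⊆ T →
      (∃ Γ, IsAlgorithmOutput T₀ K G T Fs Cs Γ) ∧
      ∀ Γ, IsAlgorithmOutput T₀ K G T Fs Cs Γ → Entails T₀ K (Clause.toQF '' G) Γ) ∧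
    (IsLocalExtension C T₀ K →
      ∀ Ks K₁ Ki : Set (Clause (L.extend E) (Var (S := S))), K = Ks ∪ K₁ ∪ Ki →
      (∀ D ∈ Ks, Clause.extFuncs D ⊆ Fs) → (∀ D ∈ K₁, Clause.extFuncs D ⊆ F₁) →
      (∀ D ∈ Ki, Clause.extFuncs D ⊆ Fi) →
      -- every symbol that is to be eliminated occurs in `G`
      (∀ f ∈ F₁, ∃ D ∈ G, f ∈ Clause.extFuncs D) →
      (∃ Γ, IsAlgorithmOutput T₀ (Ks ∪ K₁) G (est K G) Fs Cs Γ) ∧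
      ∀ Γ, IsAlgorithmOutput T₀ (Ks ∪ K₁) G (est K G) Fs Cs Γ →
        IsGeneralUniformInterpolant T₀ K (Clause.toQF '' G) Fs (Cs ∪ argConsts Fs G) Γ) := by
  refine ⟨fun T hT _ _ => ⟨exists_algorithmOutput hQE hKfin hKvars hGfin hT Fs Cs,
    fun Γ hΓ => hΓ.entails subset_rfl⟩, ?_⟩
  rintro hloc Ks K₁ Ki rfl hKs hK₁ hKi hF₁
  exact ⟨exists_algorithmOutput hQE (hKfin.subset Set.subset_union_left)
    (fun D hD => hKvars D (Or.inl hD)) hGfin (est_finite hKfin hGfin) Fs Cs,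
    fun Γ hΓ => hΓ.isGeneralUniformInterpolant hs1 h1i hKvars hGfin
      (fun t => isShallow_of_mem_est hKflat hKlin hGflat hGlin) hGsig hloc hKs hK₁ hKi hF₁⟩
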